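/- Let $\Lambda(X_1|\cdots|X_r)=\Lambda(X_1)\otimes\cdots\otimes\Lambda(X_r)$ be the ring of multi-symmetric functions over $\mathbb{Q}$ in $r$ infinite alphabets $X_i=x_{i,1}+x_{i,2}+\cdots$, i.e. the polynomial ring in the power sums $p_k(X_i)=\sum_a x_{i,a}^k$ ($1\le i\le r$, $k\ge 1$). The key polynomials $\mathcal{K}_\alpha(x_1,\dots,x_n)$, $\alpha\in\mathbb{Z}_{\ge0}^n$, are the unique polynomials with $\mathcal{K}_\alpha=x^\alpha$ if $\alpha_1\ge\cdots\ge\alpha_n$, and $\mathcal{K}_{s_a(\alpha)}=\xi_a(\mathcal{K}_\alpha)$ whenever $\alpha_a>\alpha_{a+1}$, where $s_a$ exchanges the entries (or variables) $a$ and $a+1$ and $\xi_a(f)=\frac{x_a f-x_{a+1}s_a(f)}{x_a-x_{a+1}}$. For partitions $\lambda^{(1)},\dots,\lambda^{(r)}$, the multi-symmetric Schur function is the limit of formal power series $$\mathcal{S}_{(\lambda^{(1)}|\cdots|\lambda^{(r)})}(X_1|\cdots|X_r)=\lim_{n_1,\dots,n_r\to\infty}\mathcal{K}_{(0^{n_1-\ell(\lambda^{(1)})}*\mathrm{rev}(\lambda^{(1)}))*\cdots*(0^{n_r-\ell(\lambda^{(r)})}*\mathrm{rev}(\lambda^{(r)}))}(x_{1,1},\dots,x_{1,n_1},\dots,x_{r,1},\dots,x_{r,n_r}),$$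 where $*$ is concatenation and $\mathrm{rev}(\lambda)$ lists the parts of $\lambda$ in weakly increasing order. Let $z$ be a further variable, let $\Omega(zX)=\sum_\lambda z^{|\lambda|}m_\lambda(X)$ (sum over all partitions, $m_\lambda$ the monomial symmetric functions), and let $\langle z^0\rangle$ denote the coefficient of $z^0$ in a Laurent series in $z$. For $f\in\Lambda(X_1|\cdots|X_r)$, the plethysm $f(X_1|\cdots|X_i+z^{-1}|X_{i+1}-z^{-1}|\cdots|X_r)$ is the image of $f$ under the ring homomorphism that sends $p_k(X_i)\mapsto p_k(X_i)+z^{-k}$ and $p_k(X_{i+1})\mapsto p_k(X_{i+1})-z^{-k}$ and fixes $p_k(X_l)$ for $l\ne i,i+1$. Then for all partitions $\lambda^{(1)},\dots,\lambda^{(r)}$ and every $1\le i\le r-1$ with $\lambda^{(i)}\neq\emptyset$, with $\lambda^{(i)}_1$ the largest part of $\lambda^{(i)}$, the limits defining the two multi-symmetric Schur functions below exist, $\mathcal{S}_{(\lambda^{(1)}|\cdots|\lambda^{(r)})}$ lies in $\Lambda(X_1|\cdots|X_r)$, and $$\mathcal{S}_{(\lambda^{(1)}|\cdots|\lambda^{(i)}\setminus\{\lambda^{(i)}_1\}|\lambda^{(i+1)}\cup\{\lambda^{(i)}_1\}|\cdots|\lambda^{(r)})}=\langle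 z^0\rangle\,\mathcal{S}_{(\lambda^{(1)}|\cdots|\lambda^{(r)})}(X_1|\cdots|X_i+z^{-1}|X_{i+1}-z^{-1}|\cdots|X_r)\,\Omega(zX_{i+1}).$$ -/

import Mathlib

namespace MultiSchur

open MvPolynomial

/-- The numerator `x_a f - x_b s_{ab} f` is divisible by `x_a - x_b`. -/
theorem isobaric_exists {σ : Type*} [DecidableEq σ] (a b : σ) (f : MvPolynomial σ ℚ) :
    ∃ g : MvPolynomial σ ℚ,
      (X a - X b) * g = X a * f - X b * rename (Equiv.swap a b) f := by
  have key : (X a - X b : MvPolynomial σ ℚ) ∣ f - rename (Equiv.swap a b) f := by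
    rw [← Ideal.mem_span_singleton, ← Ideal.Quotient.mk_eq_mk_iff_sub_mem]
    have hab : Ideal.Quotient.mk (Ideal.span {(X a - X b : MvPolynomial σ ℚ)}) (X a)
        = Ideal.Quotient.mk (Ideal.span {(X a - X b : MvPolynomial σ ℚ)}) (X b) :=
      (Ideal.Quotient.mk_eq_mk_iff_sub_mem _ _).2 (Ideal.mem_span_singleton_self _)
    have : (Ideal.Quotient.mkₐ ℚ (Ideal.span {(X a - X b : MvPolynomial σ ℚ)})) =
        (Ideal.Quotient.mkₐ ℚ (Ideal.span {(X a - X b : MvPolynomial σ ℚ)})).comp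
          (rename (Equiv.swap a b)) := by
      ext c
      simp only [AlgHom.comp_apply, rename_X, Ideal.Quotient.mkₐ_eq_mk]
      rcases eq_or_ne c a with rfl | hca
      · rw [Equiv.swap_apply_left, hab]
      rcases eq_or_ne c b with rfl | hcb
      · rw [Equiv.swap_apply_right, hab]
      · rw [Equiv.swap_apply_of_ne_of_ne hca hcb]
    exact DFunLike.congr_fun this f
  obtain ⟨q, hq⟩ := key
  exact ⟨f + X b * q, by linear_combination (-X b) * hq⟩

/-- The isobaric divided difference operator
`ξ_{a,b} f = (x_a f - x_b f(x_a ↔ x_b)) / (x_a - x_b)`; for `a ≠ b` the quotient is unique. -/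
noncomputable def isobaric {σ : Type*} [DecidableEq σ] (a b : σ) (f : MvPolynomial σ ℚ) :
    MvPolynomial σ ℚ :=
  (isobaric_exists a b f).choose

theorem isobaric_spec {σ : Type*} [DecidableEq σ] (a b : σ) (f : MvPolynomial σ ℚ) :
    (X a - X b) * isobaric a b f = X a * f - X b * rename (Equiv.swap a b) f :=
  (isobaric_exists a b f).choose_spec

theorem X_sub_ne {σ : Type*} {a b : σ} (h : a ≠ b) : (X a - X b : MvPolynomial σ ℚ) ≠ 0 :=
  sub_ne_zero.2 fun e => h (X_injective e)

theorem weight_swap_lt {n : ℕ} (α : Fin n → ℕ) (a b : Fin n) (hab : a < b) (h : α a < α b) :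
    ∑ i : Fin n, (i : ℕ) * (α ∘ Equiv.swap a b) i < ∑ i : Fin n, (i : ℕ) * α i := by
  have hne : a ≠ b := hab.ne
  have e : ∀ β : Fin n → ℕ, ∑ i : Fin n, (i : ℕ) * β i =
      (a : ℕ) * β a + ((b : ℕ) * β b + ∑ i ∈ (Finset.univ.erase a).erase b, (i : ℕ) * β i) := by
    intro β
    rw [Finset.add_sum_erase _ (fun i : Fin n => (i : ℕ) * β i) (by simp [hne.symm]),
      Finset.add_sum_erase _ (fun i : Fin n => (i : ℕ) * β i) (Finset.mem_univ a)]
  rw [e, e α]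
  have h3 : ∑ i ∈ (Finset.univ.erase a).erase b, (i : ℕ) * (α ∘ Equiv.swap a b) i =
      ∑ i ∈ (Finset.univ.erase a).erase b, (i : ℕ) * α i := by
    refine Finset.sum_congr rfl fun i hi => ?_
    simp only [Finset.mem_erase, Finset.mem_univ, and_true] at hi
    rw [Function.comp_apply, Equiv.swap_apply_of_ne_of_ne hi.2 hi.1]
  rw [h3]
  simp only [Function.comp_apply, Equiv.swap_apply_left, Equiv.swap_apply_right]
  have : (a : ℕ) < b := hab
  nlinarith

open Classical in
/-- The key polynomial `K_α(x_1, …, x_n)`: the monomial `x^α` if `α` is weakly decreasing, and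
`ξ_{a,a+1} K_{s_a α}` for an ascent `α_a < α_{a+1}` otherwise. The value does not depend on the
ascents used: `keyPoly_isKeyFamily` and `isKeyFamily_unique` below show that these polynomials are
the unique family with the two defining properties of key polynomials. -/
noncomputable def keyPoly {n : ℕ} (α : Fin n → ℕ) : MvPolynomial (Fin n) ℚ :=
  if h : ∃ p : Fin n × Fin n, (p.2 : ℕ) = p.1 + 1 ∧ α p.1 < α p.2 then
    isobaric h.choose.1 h.choose.2 (keyPoly (α ∘ Equiv.swap h.choose.1 h.choose.2))
  else monomial (Finsupp.equivFunOnFinite.symm α) 1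
termination_by ∑ i : Fin n, (i : ℕ) * α i
decreasing_by
  exact weight_swap_lt α _ _ (by rw [Fin.lt_def, h.choose_spec.1]; omega) h.choose_spec.2

/-- The defining properties of the key polynomials in `n` variables. -/
structure IsKeyFamily {n : ℕ} (K : (Fin n → ℕ) → MvPolynomial (Fin n) ℚ) : Prop where
  antitone : ∀ α, Antitone α → K α = monomial (Finsupp.equivFunOnFinite.symm α) 1
  step : ∀ (α : Fin n → ℕ) (a b : Fin n), (b : ℕ) = a + 1 → α b < α a →
    K (α ∘ Equiv.swap a b) = isobaric a b (K α)

theorem keyPoly_of_antitone {n : ℕ} (α : Fin n → ℕ) (h : Antitone α) :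
    keyPoly α = monomial (Finsupp.equivFunOnFinite.symm α) 1 := by
  rw [keyPoly, dif_neg]
  rintro ⟨p, hp, h1⟩
  exact absurd (h (Fin.le_def.2 (by omega))) (not_le.2 h1)

theorem exists_ascent {n : ℕ} (α : Fin n → ℕ) (h : ¬ Antitone α) :
    ∃ a b : Fin n, (b : ℕ) = a + 1 ∧ α a < α b := by
  by_contra hc
  push Not at hc
  apply h
  rcases n with _ | n
  · intro a; exact a.elim0
  · rw [Fin.antitone_iff_succ_le]
    intro i
    exact hc _ _ (by simp)

/-- The defining properties determine the key polynomials. -/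
theorem isKeyFamily_unique {n : ℕ} {K L : (Fin n → ℕ) → MvPolynomial (Fin n) ℚ}
    (hK : IsKeyFamily K) (hL : IsKeyFamily L) (α : Fin n → ℕ) : K α = L α := by
  by_cases h : Antitone α
  · rw [hK.antitone α h, hL.antitone α h]
  · obtain ⟨a, b, hab, h1⟩ := exists_ascent α h
    have e : α = (α ∘ Equiv.swap a b) ∘ Equiv.swap a b := by
      ext x; simp
    have ih := isKeyFamily_unique hK hL (α ∘ Equiv.swap a b)
    rw [e, hK.step _ _ _ hab (by simpa using h1), hL.step _ _ _ hab (by simpa using h1), ih]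
termination_by ∑ i : Fin n, (i : ℕ) * α i
decreasing_by exact weight_swap_lt α _ _ (by rw [Fin.lt_def]; omega) h1

theorem swap_mul_comm {σ : Type*} [DecidableEq σ] {a b c d : σ}
    (hac : a ≠ c) (had : a ≠ d) (hbc : b ≠ c) (hbd : b ≠ d) :
    Equiv.swap a b * Equiv.swap c d = Equiv.swap c d * Equiv.swap a b := by
  have : Equiv.Perm.Disjoint (Equiv.swap a b) (Equiv.swap c d) := by
    intro x
    by_cases hxa : x = a
    · right; subst hxa; exact Equiv.swap_apply_of_ne_of_ne hac had
    by_cases hxb : x = b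
    · right; subst hxb; exact Equiv.swap_apply_of_ne_of_ne hbc hbd
    · left; exact Equiv.swap_apply_of_ne_of_ne hxa hxb
  exact this.commute.eq

theorem swap_braid {σ : Type*} [DecidableEq σ] {a b c : σ} (hab : a ≠ b) (hac : a ≠ c)
    (hbc : b ≠ c) : Equiv.swap b c * (Equiv.swap a b * Equiv.swap b c) =
      Equiv.swap a b * (Equiv.swap b c * Equiv.swap a b) := by
  ext x
  simp only [Equiv.Perm.mul_apply, Equiv.swap_apply_def]
  split_ifs <;> simp_all

theorem isobaric_comm {σ : Type*} [DecidableEq σ] {a b c d : σ} (hab : a ≠ b) (hcd : c ≠ d)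
    (hac : a ≠ c) (had : a ≠ d) (hbc : b ≠ c) (hbd : b ≠ d) (f : MvPolynomial σ ℚ) :
    isobaric a b (isobaric c d f) = isobaric c d (isobaric a b f) := by
  have r : ∀ (p q : Equiv.Perm σ) (g : MvPolynomial σ ℚ), rename p (rename q g) = rename (p * q : Equiv.Perm σ) g := by
    intro p q g; rw [rename_rename]; rfl
  have h1 := isobaric_spec a b (isobaric c d f)
  have h2 := isobaric_spec c d f
  have h3 := isobaric_spec c d (isobaric a b f)
  have h4 := isobaric_spec a b f
  have h5 := congrArg (rename (Equiv.swap a b)) h2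
  have h6 := congrArg (rename (Equiv.swap c d)) h4
  have hc := swap_mul_comm hac had hbc hbd
  simp only [map_mul, map_sub, rename_X, r, hc,
    Equiv.swap_apply_of_ne_of_ne hac.symm hbc.symm, Equiv.swap_apply_of_ne_of_ne had.symm hbd.symm,
    Equiv.swap_apply_of_ne_of_ne hac had, Equiv.swap_apply_of_ne_of_ne hbc hbd] at h5 h6
  apply mul_left_cancel₀ (mul_ne_zero (X_sub_ne hab) (X_sub_ne hcd))
  linear_combination (X c - X d) * h1 - (X a - X b) * h3 + X a * h2 - X c * h4 - X b * h5 + X d * h6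

theorem isobaric_braid {σ : Type*} [DecidableEq σ] {a b c : σ} (hab : a ≠ b) (hac : a ≠ c)
    (hbc : b ≠ c) (f : MvPolynomial σ ℚ) :
    isobaric a b (isobaric b c (isobaric a b f)) =
      isobaric b c (isobaric a b (isobaric b c f)) := by
  have r : ∀ (p q : Equiv.Perm σ) (g : MvPolynomial σ ℚ), rename p (rename q g) = rename (p * q : Equiv.Perm σ) g := by
    intro p q g; rw [rename_rename]; rfl
  have e3 := swap_braid hab hac hbc
  have sc : Equiv.swap a b c = c := Equiv.swap_apply_of_ne_of_ne hac.symm hbc.symm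
  have ta : Equiv.swap b c a = a := Equiv.swap_apply_of_ne_of_ne hab hac
  have h1 := isobaric_spec a b (isobaric b c (isobaric a b f))
  have h2 := isobaric_spec b c (isobaric a b f)
  have h3 := congrArg (rename (Equiv.swap a b)) h2
  have h4 := isobaric_spec a b f
  have h5 := congrArg (rename (Equiv.swap b c)) h4
  have h6 := congrArg (rename (Equiv.swap a b)) h4
  have h7 := congrArg (rename (Equiv.swap a b)) h5
  have g1 := isobaric_spec b c (isobaric a b (isobaric b c f))
  have g2 := isobaric_spec a b (isobaric b c f)
  have g3 := congrArg (rename (Equiv.swap b c)) g2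
  have g4 := isobaric_spec b c f
  have g5 := congrArg (rename (Equiv.swap a b)) g4
  have g6 := congrArg (rename (Equiv.swap b c)) g4
  have g7 := congrArg (rename (Equiv.swap b c)) g5
  simp only [map_mul, map_sub, rename_X, r, sc, ta, Equiv.swap_apply_left,
    Equiv.swap_apply_right, Equiv.swap_mul_self, Equiv.Perm.coe_one, rename_id_apply, e3]
    at h3 h5 h6 h7 g3 g5 g6 g7
  have hx := X_sub_ne hab
  have hy := X_sub_ne hbc
  have hz := X_sub_ne hac
  apply mul_left_cancel₀ (mul_ne_zero (mul_ne_zero (pow_ne_zero 2 hx) (pow_ne_zero 2 hy)) hz)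
  generalize (X a : MvPolynomial σ ℚ) = x at *
  generalize (X b : MvPolynomial σ ℚ) = y at *
  generalize (X c : MvPolynomial σ ℚ) = z at *
  linear_combination (x - y) * (y - z) ^ 2 * (x - z) * h1 + x * (x - y) * (y - z) * (x - z) * h2
    - y * (x - y) * (y - z) ^ 2 * h3 + x * y * (y - z) * (x - z) * h4
    - x * z * (x - y) * (y - z) * h5 + x * y * (y - z) ^ 2 * h6 + y * z * (x - y) * (y - z) * h7
    - (x - y) ^ 2 * (y - z) * (x - z) * g1 - y * (x - y) * (x - z) * (y - z) * g2
    + z * (x - y) ^ 2 * (y - z) * g3 - x * y * (x - y) * (x - z) * g4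
    + y ^ 2 * (x - y) * (y - z) * g5 - z * x * (x - y) ^ 2 * g6 - z ^ 2 * (x - y) * (y - z) * g7

theorem keyPoly_of_ascent {n : ℕ} (β : Fin n → ℕ) (a b : Fin n) (hab : (b : ℕ) = a + 1)
    (h : β a < β b) : keyPoly β = isobaric a b (keyPoly (β ∘ Equiv.swap a b)) := by
  have hex : ∃ p : Fin n × Fin n, (p.2 : ℕ) = p.1 + 1 ∧ β p.1 < β p.2 := ⟨(a, b), hab, h⟩
  obtain ⟨c, d, hcd, hβ, hk⟩ : ∃ c d : Fin n, (d : ℕ) = c + 1 ∧ β c < β d ∧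
      keyPoly β = isobaric c d (keyPoly (β ∘ Equiv.swap c d)) := by
    refine ⟨hex.choose.1, hex.choose.2, hex.choose_spec.1, hex.choose_spec.2, ?_⟩
    rw [keyPoly, dif_pos hex]
  have w1 := weight_swap_lt β a b (by rw [Fin.lt_def]; omega) h
  have w2 := weight_swap_lt β c d (by rw [Fin.lt_def]; omega) hβ
  -- two overlapping ascents `u, u + 1, u + 2`, in either role
  have braid : ∀ u v w : Fin n, (v : ℕ) = u + 1 → (w : ℕ) = v + 1 → β u < β v → β v < β w →
      ∑ i : Fin n, (i : ℕ) * (β ∘ Equiv.swap u v) i < ∑ i : Fin n, (i : ℕ) * β i →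
      ∑ i : Fin n, (i : ℕ) * (β ∘ Equiv.swap v w) i < ∑ i : Fin n, (i : ℕ) * β i →
      isobaric u v (keyPoly (β ∘ Equiv.swap u v)) =
        isobaric v w (keyPoly (β ∘ Equiv.swap v w)) := by
    intro u v w huv hvw h1 h2 l1 l2
    have nuv : u ≠ v := fun e => by rw [Fin.ext_iff] at e; omega
    have nvw : v ≠ w := fun e => by rw [Fin.ext_iff] at e; omega
    have nuw : u ≠ w := fun e => by rw [Fin.ext_iff] at e; omega
    have fw : Equiv.swap u v w = w := Equiv.swap_apply_of_ne_of_ne nuw.symm nvw.symm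
    have fu : Equiv.swap v w u = u := Equiv.swap_apply_of_ne_of_ne nuv nuw
    have luv : u < v := by rw [Fin.lt_def]; omega
    have lvw : v < w := by rw [Fin.lt_def]; omega
    have a1 : (β ∘ Equiv.swap u v) v < (β ∘ Equiv.swap u v) w := by
      simpa [fw] using h1.trans h2
    have b1 : (β ∘ Equiv.swap v w) u < (β ∘ Equiv.swap v w) v := by
      simpa [fu] using h1.trans h2
    have l3 := (weight_swap_lt _ v w lvw a1).trans l1
    have l4 := (weight_swap_lt _ u v luv b1).trans l2
    have a2 : ((β ∘ Equiv.swap u v) ∘ Equiv.swap v w) u <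
        ((β ∘ Equiv.swap u v) ∘ Equiv.swap v w) v := by simpa [fu, fw] using h2
    have b2 : ((β ∘ Equiv.swap v w) ∘ Equiv.swap u v) v <
        ((β ∘ Equiv.swap v w) ∘ Equiv.swap u v) w := by simpa [fu, fw] using h1
    rw [keyPoly_of_ascent (β ∘ Equiv.swap u v) v w hvw a1,
      keyPoly_of_ascent ((β ∘ Equiv.swap u v) ∘ Equiv.swap v w) u v huv a2,
      keyPoly_of_ascent (β ∘ Equiv.swap v w) u v huv b1,
      keyPoly_of_ascent ((β ∘ Equiv.swap v w) ∘ Equiv.swap u v) v w hvw b2,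
      isobaric_braid nuv nuw nvw]
    have e : ((β ∘ Equiv.swap u v) ∘ Equiv.swap v w) ∘ Equiv.swap u v =
        ((β ∘ Equiv.swap v w) ∘ Equiv.swap u v) ∘ Equiv.swap v w :=
      congrArg (fun p : Equiv.Perm (Fin n) => β ∘ p) (swap_braid nuv nuw nvw).symm
    rw [e]
  -- two ascents far apart
  have far : ∀ a b c d : Fin n, (b : ℕ) = a + 1 → (d : ℕ) = c + 1 → β a < β b → β c < β d →
      ∑ i : Fin n, (i : ℕ) * (β ∘ Equiv.swap a b) i < ∑ i : Fin n, (i : ℕ) * β i →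
      ∑ i : Fin n, (i : ℕ) * (β ∘ Equiv.swap c d) i < ∑ i : Fin n, (i : ℕ) * β i →
      (a : ℕ) < c → b ≠ c →
      isobaric c d (keyPoly (β ∘ Equiv.swap c d)) =
        isobaric a b (keyPoly (β ∘ Equiv.swap a b)) := by
    intro a b c d hab hcd h1 h2 l1 l2 hac hbc'
    have hbc : (b : ℕ) ≠ c := fun e => hbc' (Fin.ext e)
    have nab : a ≠ b := fun e => by rw [Fin.ext_iff] at e; omega
    have ncd : c ≠ d := fun e => by rw [Fin.ext_iff] at e; omega
    have nac : a ≠ c := fun e => by rw [Fin.ext_iff] at e; omega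
    have nad : a ≠ d := fun e => by rw [Fin.ext_iff] at e; omega
    have nbd : b ≠ d := fun e => by rw [Fin.ext_iff] at e; omega
    have a1 : (β ∘ Equiv.swap c d) a < (β ∘ Equiv.swap c d) b := by
      simpa [Equiv.swap_apply_of_ne_of_ne nac nad, Equiv.swap_apply_of_ne_of_ne hbc' nbd] using h1
    have b1 : (β ∘ Equiv.swap a b) c < (β ∘ Equiv.swap a b) d := by
      simpa [Equiv.swap_apply_of_ne_of_ne nac.symm hbc'.symm,
        Equiv.swap_apply_of_ne_of_ne nad.symm nbd.symm] using h2
    rw [keyPoly_of_ascent (β ∘ Equiv.swap c d) a b hab a1,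
      keyPoly_of_ascent (β ∘ Equiv.swap a b) c d hcd b1,
      isobaric_comm nab ncd nac nad hbc' nbd]
    have e : (β ∘ Equiv.swap c d) ∘ Equiv.swap a b = (β ∘ Equiv.swap a b) ∘ Equiv.swap c d :=
      congrArg (fun p : Equiv.Perm (Fin n) => β ∘ p) (swap_mul_comm nac nad hbc' nbd).symm
    rw [e]
  rw [hk]
  rcases lt_trichotomy (a : ℕ) c with hac | hac | hac
  · by_cases hbc : b = c
    · subst hbc
      exact (braid a b d hab hcd h hβ w1 w2).symm
    · exact far a b c d hab hcd h hβ w1 w2 hac hbc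
  · obtain rfl : a = c := Fin.ext hac
    obtain rfl : b = d := Fin.ext (by omega)
    rfl
  · by_cases hbc : d = a
    · subst hbc
      exact braid c d b hcd hab hβ h w2 w1
    · exact (far c d a b hcd hab hβ h w2 w1 hac hbc).symm
termination_by ∑ i : Fin n, (i : ℕ) * β i
decreasing_by all_goals assumption

/-- `keyPoly` has the defining properties of the key polynomials. -/
theorem keyPoly_isKeyFamily {n : ℕ} : IsKeyFamily (keyPoly (n := n)) where
  antitone := keyPoly_of_antitone
  step α a b hab h := by
    rw [keyPoly_of_ascent (α ∘ Equiv.swap a b) a b hab (by simpa using h)]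
    congr 2
    funext x
    simp

/-- Partitions of arbitrary size. -/
abbrev Par : Type := Σ n : ℕ, n.Partition

/-- The largest part `λ_1` (and `0` for the empty partition). -/
def Par.largest (lam : Par) : ℕ := lam.2.parts.sup

/-- `λ ∖ {λ_1}`. -/
def Par.removeLargest (lam : Par) : Par :=
  ⟨_, Nat.Partition.ofMultiset (lam.2.parts.erase lam.largest)⟩

/-- `λ ∪ {p}`, for `p > 0`. -/
def Par.insertPart (lam : Par) (p : ℕ) : Par :=
  ⟨_, Nat.Partition.ofMultiset (p ::ₘ lam.2.parts)⟩

/-- Move the largest part of `λ^(i)` into `λ^(j)`, for `i ≠ j`. -/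
def moveLargest {r : ℕ} (lam : Fin r → Par) (i j : Fin r) : Fin r → Par :=
  Function.update (Function.update lam i (lam i).removeLargest) j
    ((lam j).insertPart (lam i).largest)

/-- The composition `0^{n - ℓ(λ)} * rev(λ)` of length `n`, for `n ≥ ℓ(λ)`: its last entry is `λ_1`,
the one before it `λ_2`, and so on. -/
def Par.revPad (lam : Par) (n : ℕ) (k : Fin n) : ℕ :=
  (lam.2.parts.sort (· ≥ ·)).getD (n - 1 - k) 0

/-- Formal power series over `ℚ` in `r` infinite alphabets `X_i = x_{i,0} + x_{i,1} + ⋯`. -/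
abbrev Series (r : ℕ) : Type := MvPowerSeries (Fin r × ℕ) ℚ

/-- The multi-symmetric Schur polynomial in alphabets of sizes `n_1, …, n_r`: the key polynomial of
the concatenation of the compositions `0^{n_i - ℓ(λ^(i))} * rev(λ^(i))`, in the concatenated
variables `x_{1,0}, …, x_{1,n_1-1}, …, x_{r,0}, …, x_{r,n_r-1}`. (`finSigmaFinEquiv` numbers the
pairs `(i, k)` with `k < n_i` in lexicographic order.) -/
noncomputable def multiSchurPoly {r : ℕ} (lam : Fin r → Par) (n : Fin r → ℕ) :
    MvPolynomial (Fin r × ℕ) ℚ :=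
  rename (fun k => ((finSigmaFinEquiv.symm k).1, ((finSigmaFinEquiv.symm k).2 : ℕ)))
    (keyPoly fun k : Fin (∑ i, n i) =>
      (lam (finSigmaFinEquiv.symm k).1).revPad _ (finSigmaFinEquiv.symm k).2)

/-- `F` is the limit of `P n` as all `n_1, …, n_r → ∞`, as formal power series: every coefficient is
eventually constant. -/
def IsStableLimit {r : ℕ} (P : (Fin r → ℕ) → MvPolynomial (Fin r × ℕ) ℚ) (F : Series r) : Prop :=
  ∀ m : (Fin r × ℕ) →₀ ℕ, ∀ᶠ n in Filter.atTop, MvPolynomial.coeff m (P n) = MvPowerSeries.coeff m F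

open Classical in
/-- The multi-symmetric Schur function: the limit of the multi-symmetric Schur polynomials. -/
noncomputable def multiSchur {r : ℕ} (lam : Fin r → Par) : Series r :=
  if h : ∃ F, IsStableLimit (multiSchurPoly lam) F then h.choose else 0

open Classical in
/-- The power sum `p_k(X_i) = ∑_a x_{i,a}^k`, `k ≥ 1`. -/
noncomputable def powerSum {r : ℕ} (i : Fin r) (k : ℕ+) : Series r :=
  fun m => if ∃ a : ℕ, m = Finsupp.single (i, a) (k : ℕ) then 1 else 0

/-- Polynomials in the (algebraically independent) power sums, as power series. -/
noncomputable def ofPowerSums (r : ℕ) : MvPolynomial (Fin r × ℕ+) ℚ →ₐ[ℚ] Series r :=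
  aeval fun q => powerSum q.1 q.2

/-- The ring of multi-symmetric functions `Λ(X_1) ⊗ ⋯ ⊗ Λ(X_r)` over `ℚ`, where
`Λ(X_i) = ℚ[p_1(X_i), p_2(X_i), …]`. -/
noncomputable def MultiSym (r : ℕ) : Subalgebra ℚ (Series r) := (ofPowerSums r).range

/-- Plethystic substitution `f(E_1 | ⋯ | E_r)` of a multi-symmetric function `f`: expand `f` in
power sums and replace `p_k(X_i)` by `E i k = p_k(E_i)`. The expansion of an element of `MultiSym r`
exists by definition and is unique because the power sums are algebraically independent. -/
noncomputable def plethysm {r : ℕ} {A : Type*} [CommRing A] [Algebra ℚ A] (E : Fin r → ℕ+ → A)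
    (f : Series r) : A :=
  aeval (fun q : Fin r × ℕ+ => E q.1 q.2) (Function.invFun (ofPowerSums r) f)

/-- The monomial `z^e` in the Laurent series in `z` over the power series. -/
noncomputable def zPow {r : ℕ} (e : ℤ) : LaurentSeries (Series r) := HahnSeries.single e 1

/-- The alphabets `(… | X_i + z⁻¹ | X_j - z⁻¹ | …)`, for `i ≠ j`: the value of `p_k` on the alphabet
`l`. -/
noncomputable def shift {r : ℕ} (i j : Fin r) (l : Fin r) (k : ℕ+) :
    LaurentSeries (Series r) :=
  HahnSeries.C (powerSum l k) + (if l = i then zPow (-(k : ℤ)) else 0)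
    - (if l = j then zPow (-(k : ℤ)) else 0)

open Classical in
/-- The monomial symmetric function `m_λ(X_i)`: the sum of all monomials in the variables `x_{i,a}`
whose nonzero exponents are the parts of `λ`. -/
noncomputable def monomialSymm {r : ℕ} (i : Fin r) {n : ℕ} (lam : n.Partition) : Series r :=
  fun m => if (∀ v ∈ m.support, v.1 = i) ∧ m.support.val.map m = lam.parts then 1 else 0

/-- The plethystic exponential `Ω(z X_i) = ∑_λ m_λ(z X_i) = ∑_n z^n ∑_{λ ⊢ n} m_λ(X_i)`. -/
noncomputable def omegaZ {r : ℕ} (i : Fin r) : LaurentSeries (Series r) :=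
  HahnSeries.ofPowerSeries ℤ (Series r)
    (PowerSeries.mk fun n => ∑ lam : n.Partition, monomialSymm i lam)

end MultiSchur

open MultiSchur

/-!
Let `p` be the largest part of `λ^(i)`, `y` the first variable of `X_j`, and `f` the expansion of
the key polynomials in power sums. In the alphabets `X_i + y` and `X_j - y` the part `p` is the last
entry of the block `i`, at the variable `y`. For the alphabets `X_i` and `X_j` the same composition
has `p` as the first entry of the block `j`, and sorting `p` into that block applies the operators
`ξ` along `X_j`. Since `f(⋯ | X_i + y | X_j - y | ⋯)` is a polynomial in `y` whose coefficients are
symmetric in the variables of `X_j`, only the powers `y ^ m` are affected, and the chain of `ξ`s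
turns `y ^ m` into `h_m(X_j) = ⟨z⁰⟩ z⁻ᵐ Ω(z X_j)`.

The same step shows that the polynomials expand in power sums independently of the sizes of the
alphabets, which gives the limits: insert the parts in weakly increasing order, each at the first
block, where a dominant first entry `p` just contributes a factor `y ^ p`, and carry it from block
to block to its place.
-/

namespace MultiSchur

open MvPolynomial

section Isobaric

variable {σ τ : Type*} [DecidableEq σ] [DecidableEq τ] {a b : σ}

theorem isobaric_eq_of_spec (hab : a ≠ b) {f g : MvPolynomial σ ℚ}
    (h : (X a - X b) * g = X a * f - X b * rename (Equiv.swap a b) f) : isobaric a b f = g :=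
  mul_left_cancel₀ (X_sub_ne hab) ((isobaric_spec a b f).trans h.symm)

theorem isobaric_of_rename_swap (hab : a ≠ b) {f : MvPolynomial σ ℚ}
    (h : rename (Equiv.swap a b) f = f) : isobaric a b f = f :=
  isobaric_eq_of_spec hab (by rw [h]; ring)

theorem rename_swap_rename_swap (a b : σ) (f : MvPolynomial σ ℚ) :
    rename (Equiv.swap a b) (rename (Equiv.swap a b) f) = f := by
  rw [rename_rename, ← Equiv.Perm.coe_mul, Equiv.swap_mul_self, Equiv.Perm.coe_one, rename_id_apply]

theorem rename_swap_isobaric (hab : a ≠ b) (f : MvPolynomial σ ℚ) :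
    rename (Equiv.swap a b) (isobaric a b f) = isobaric a b f := by
  have h := isobaric_spec a b f
  have h_swap := congrArg (rename (Equiv.swap a b)) h
  simp only [map_mul, map_sub, rename_X, Equiv.swap_apply_left, Equiv.swap_apply_right,
    rename_swap_rename_swap] at h_swap
  exact mul_left_cancel₀ (X_sub_ne hab) (by linear_combination -h - h_swap)

theorem isobaric_isobaric (hab : a ≠ b) (f : MvPolynomial σ ℚ) :
    isobaric a b (isobaric a b f) = isobaric a b f :=
  isobaric_of_rename_swap hab (rename_swap_isobaric hab f)

theorem isobaric_sum_mul {κ : Type*} (hab : a ≠ b) (s : Finset κ) {g : κ → MvPolynomial σ ℚ}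
    (hg : ∀ k ∈ s, rename (Equiv.swap a b) (g k) = g k) (f : κ → MvPolynomial σ ℚ) :
    isobaric a b (∑ k ∈ s, g k * f k) = ∑ k ∈ s, g k * isobaric a b (f k) := by
  refine isobaric_eq_of_spec hab ?_
  rw [map_sum, Finset.mul_sum, Finset.mul_sum, Finset.mul_sum, ← Finset.sum_sub_distrib]
  refine Finset.sum_congr rfl fun k hk => ?_
  rw [map_mul, hg k hk]
  linear_combination g k * isobaric_spec a b (f k)

theorem isobaric_mul (hab : a ≠ b) {g : MvPolynomial σ ℚ} (hg : rename (Equiv.swap a b) g = g)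
    (f : MvPolynomial σ ℚ) : isobaric a b (g * f) = g * isobaric a b f := by
  simpa using isobaric_sum_mul hab {()} (g := fun _ => g) (fun _ _ => hg) (fun _ => f)

theorem rename_isobaric (hab : a ≠ b) {v : σ → τ} (hv : Function.Injective v)
    (f : MvPolynomial σ ℚ) :
    rename v (isobaric a b f) = isobaric (v a) (v b) (rename v f) := by
  refine (isobaric_eq_of_spec (hv.ne hab) ?_).symm
  have h := congrArg (rename v) (isobaric_spec a b f)
  simp only [map_mul, map_sub, rename_X] at h
  rw [h, rename_rename, rename_rename]
  congr 4
  funext c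
  simp [hv.map_swap]

theorem isobaric_X_pow (hab : a ≠ b) (m : ℕ) :
    isobaric a b (X a ^ m) =
      ∑ k ∈ Finset.range (m + 1), (X a : MvPolynomial σ ℚ) ^ k * X b ^ (m - k) := by
  refine isobaric_eq_of_spec hab ?_
  have h := (Commute.all (X a : MvPolynomial σ ℚ) (X b)).mul_geom_sum₂ (m + 1)
  simp only [add_tsub_cancel_right] at h
  rw [h]
  simp [pow_succ']

end Isobaric

section KeyPoly

variable {n : ℕ} {α : Fin n → ℕ} {a b c d : Fin n}

theorem keyPoly_eq_prod_of_antitone (h : Antitone α) : keyPoly α = ∏ k, X k ^ α k := by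
  rw [keyPoly_of_antitone α h, monomial_eq, Finsupp.prod_fintype _ _ (by simp)]
  simp

theorem isobaric_keyPoly_of_antitone (hab : a ≠ b) (hα : Antitone α) (h : α a = α b) :
    isobaric a b (keyPoly α) = keyPoly α := by
  refine isobaric_of_rename_swap hab ?_
  have h_swap : ∀ k, α (Equiv.swap a b k) = α k := fun k => by
    rw [Equiv.swap_apply_def]
    split_ifs with hka hkb <;> simp [*]
  simp only [keyPoly_eq_prod_of_antitone hα, map_prod, map_pow, rename_X]
  exact Fintype.prod_equiv (Equiv.swap a b) _ _ fun k => by rw [h_swap]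

theorem isobaric_keyPoly_of_eq_of_lt_right (hab : (b : ℕ) = a + 1) (hbd : (d : ℕ) = b + 1)
    (h : α a = α b) (hlt : α b < α d)
    (ih : isobaric b d (keyPoly ((α ∘ Equiv.swap b d) ∘ Equiv.swap a b)) =
      keyPoly ((α ∘ Equiv.swap b d) ∘ Equiv.swap a b)) :
    isobaric a b (keyPoly α) = keyPoly α := by
  have hne_ab : a ≠ b := Fin.ne_of_val_ne (by omega)
  have hne_bd : b ≠ d := Fin.ne_of_val_ne (by omega)
  have hne_ad : a ≠ d := Fin.ne_of_val_ne (by omega)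
  have hlt' : (α ∘ Equiv.swap b d) a < (α ∘ Equiv.swap b d) b := by
    simpa [Equiv.swap_apply_of_ne_of_ne hne_ab hne_ad, h] using hlt
  rw [keyPoly_of_ascent α b d hbd hlt, keyPoly_of_ascent _ a b hab hlt',
    isobaric_braid hne_ab hne_ad hne_bd, ih]

theorem isobaric_keyPoly_of_eq_of_lt_left (hab : (b : ℕ) = a + 1) (hca : (a : ℕ) = c + 1)
    (h : α a = α b) (hlt : α c < α a)
    (ih : isobaric c a (keyPoly ((α ∘ Equiv.swap c a) ∘ Equiv.swap a b)) =
      keyPoly ((α ∘ Equiv.swap c a) ∘ Equiv.swap a b)) :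
    isobaric a b (keyPoly α) = keyPoly α := by
  have hne_ab : a ≠ b := Fin.ne_of_val_ne (by omega)
  have hne_ca : c ≠ a := Fin.ne_of_val_ne (by omega)
  have hne_cb : c ≠ b := Fin.ne_of_val_ne (by omega)
  have hlt' : (α ∘ Equiv.swap c a) a < (α ∘ Equiv.swap c a) b := by
    simpa [Equiv.swap_apply_of_ne_of_ne hne_cb.symm hne_ab.symm, ← h] using hlt
  rw [keyPoly_of_ascent α c a hca hlt, keyPoly_of_ascent _ a b hab hlt',
    ← isobaric_braid hne_ca hne_cb hne_ab, ih]

theorem isobaric_keyPoly_of_eq (α : Fin n → ℕ) (a b : Fin n) (hab : (b : ℕ) = a + 1)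
    (h : α a = α b) : isobaric a b (keyPoly α) = keyPoly α := by
  have hne_ab : a ≠ b := Fin.ne_of_val_ne (by omega)
  by_cases hα : Antitone α
  · exact isobaric_keyPoly_of_antitone hne_ab hα h
  obtain ⟨c, d, hcd, hlt⟩ := exists_ascent α hα
  have hne_cd : c ≠ d := Fin.ne_of_val_ne (by omega)
  have hw := weight_swap_lt α c d (Fin.lt_def.2 (by omega)) hlt
  rcases eq_or_ne b c with rfl | hne_bc
  · have hne_ad : a ≠ d := Fin.ne_of_val_ne (by omega)
    have ha := Equiv.swap_apply_of_ne_of_ne hne_ab hne_ad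
    have hd := Equiv.swap_apply_of_ne_of_ne hne_ad.symm hne_cd.symm
    have hw' := (weight_swap_lt (α ∘ Equiv.swap b d) a b (Fin.lt_def.2 (by omega))
      (by simpa [ha, h] using hlt)).trans hw
    exact isobaric_keyPoly_of_eq_of_lt_right hab hcd h hlt
      (isobaric_keyPoly_of_eq _ b d hcd (by simpa [ha, hd] using h))
  rcases eq_or_ne a d with rfl | hne_ad
  · have hne_cb : c ≠ b := Fin.ne_of_val_ne (by omega)
    have hb := Equiv.swap_apply_of_ne_of_ne hne_cb.symm hne_ab.symm
    have hc := Equiv.swap_apply_of_ne_of_ne hne_cd hne_cb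
    have hw' := (weight_swap_lt (α ∘ Equiv.swap c a) a b (Fin.lt_def.2 (by omega))
      (by simpa [hb, ← h] using hlt)).trans hw
    exact isobaric_keyPoly_of_eq_of_lt_left hab hcd h hlt
      (isobaric_keyPoly_of_eq _ c a hcd (by simpa [hb, hc] using h))
  have hne_ac : a ≠ c := by
    rintro rfl
    obtain rfl : b = d := Fin.ext (by omega)
    exact hlt.ne h
  have hne_bd : b ≠ d := fun e => hne_ac (Fin.ext (by rw [e] at hab; omega))
  rw [keyPoly_of_ascent α c d hcd hlt, isobaric_comm hne_ab hne_cd hne_ac hne_ad hne_bc hne_bd,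
    isobaric_keyPoly_of_eq (α ∘ Equiv.swap c d) a b hab
      (by simp [Equiv.swap_apply_of_ne_of_ne, *])]
termination_by ∑ k : Fin n, (k : ℕ) * α k
decreasing_by all_goals assumption

theorem isobaric_keyPoly_of_le (hab : (b : ℕ) = a + 1) (h : α a ≤ α b) :
    isobaric a b (keyPoly α) = keyPoly α := by
  rcases h.lt_or_eq with h | h
  · rw [keyPoly_of_ascent α a b hab h, isobaric_isobaric (Fin.ne_of_val_ne (by omega))]
  · exact isobaric_keyPoly_of_eq α a b hab h

theorem keyPoly_cons (α : Fin n → ℕ) {p : ℕ} (hp : ∀ k, α k ≤ p) :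
    keyPoly (Fin.cons p α : Fin (n + 1) → ℕ) = X 0 ^ p * rename Fin.succ (keyPoly α) := by
  by_cases hα : Antitone α
  · have h_cons : Antitone (Fin.cons p α : Fin (n + 1) → ℕ) := by
      refine Fin.cases (fun l _ => ?_) fun k => Fin.cases (fun h => ?_) fun l h => ?_
      · exact Fin.cases le_rfl hp l
      · exact absurd h (Fin.succ_pos k).not_ge
      · exact hα (Fin.succ_le_succ_iff.1 h)
    rw [keyPoly_eq_prod_of_antitone h_cons, keyPoly_eq_prod_of_antitone hα, Fin.prod_univ_succ]
    simp
  obtain ⟨a, b, hab, hlt⟩ := exists_ascent α hα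
  have hne : a ≠ b := Fin.ne_of_val_ne (by omega)
  have h_swap : (Fin.cons p α : Fin (n + 1) → ℕ) ∘ Equiv.swap a.succ b.succ =
      Fin.cons p (α ∘ Equiv.swap a b) := by
    refine funext (Fin.cases ?_ fun k => ?_)
    · simp [Equiv.swap_apply_of_ne_of_ne (Fin.succ_ne_zero a).symm (Fin.succ_ne_zero b).symm]
    · simp [← (Fin.succ_injective n).map_swap]
  have hX : rename (Equiv.swap a.succ b.succ) (X 0 ^ p : MvPolynomial (Fin (n + 1)) ℚ) =
      X 0 ^ p := by
    rw [map_pow, rename_X,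
      Equiv.swap_apply_of_ne_of_ne (Fin.succ_ne_zero a).symm (Fin.succ_ne_zero b).symm]
  rw [keyPoly_of_ascent (Fin.cons p α) a.succ b.succ (by simpa using hab) (by simpa using hlt),
    h_swap, keyPoly_cons (α ∘ Equiv.swap a b) fun k => hp _,
    isobaric_mul ((Fin.succ_injective n).ne hne) hX, ← rename_isobaric hne (Fin.succ_injective n),
    ← keyPoly_of_ascent α a b hab hlt]
termination_by ∑ k : Fin n, (k : ℕ) * α k
decreasing_by exact weight_swap_lt α a b (Fin.lt_def.2 (by omega)) hlt

end KeyPoly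

section KeyWord

variable {σ : Type*}

/-- The key polynomial of a word of pairs (variable, exponent): the `k`-th variable of the key
polynomial of the exponents is replaced by the `k`-th letter of the word. -/
noncomputable def keyWord (l : List (σ × ℕ)) : MvPolynomial σ ℚ :=
  rename (fun k : Fin l.length => l[k].1) (keyPoly fun k => l[k].2)

theorem keyWord_eq {N : ℕ} (l : List (σ × ℕ)) (h : l.length = N) (v : Fin N → σ) (e : Fin N → ℕ)
    (hl : ∀ k : Fin N, l[k] = (v k, e k)) : keyWord l = rename v (keyPoly e) := by
  subst h
  obtain rfl : v = fun k : Fin l.length => l[k].1 := funext fun k => by rw [hl]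
  obtain rfl : e = fun k : Fin l.length => l[k].2 := funext fun k => by rw [hl]
  rfl

theorem keyWord_eq_one {l : List (σ × ℕ)} (hl : ∀ w ∈ l, w.2 = 0) : keyWord l = 1 := by
  have h_zero : (fun k : Fin l.length => l[k].2) = fun _ => 0 :=
    funext fun k => hl _ (List.getElem_mem k.isLt)
  rw [keyWord, h_zero, keyPoly_eq_prod_of_antitone antitone_const]
  simp

theorem keyWord_cons_of_forall_le {x : σ} {p : ℕ} {l : List (σ × ℕ)} (hl : ∀ w ∈ l, w.2 ≤ p) :
    keyWord ((x, p) :: l) = X x ^ p * keyWord l := by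
  have h_cons := keyWord_eq ((x, p) :: l) (List.length_cons ..)
    (Fin.cons x fun k : Fin l.length => l[k].1) (Fin.cons p fun k : Fin l.length => l[k].2)
    (Fin.cases rfl fun _ => rfl)
  rw [h_cons, keyPoly_cons (fun k : Fin l.length => l[k].2) fun k => hl _ (List.getElem_mem k.isLt),
    map_mul, map_pow, rename_X, rename_rename, keyWord]
  rfl

theorem fst_getElem_injective {l : List (σ × ℕ)} (hl : (l.map Prod.fst).Nodup) :
    Function.Injective (fun k : Fin l.length => l[k].1) := fun j k hjk =>
  Fin.ext <| (hl.getElem_inj_iff (hi := by simp) (hj := by simp)).1 (by simpa using hjk)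

variable [DecidableEq σ]

theorem isobaric_keyWord {l : List (σ × ℕ)} (hl : (l.map Prod.fst).Nodup) {a b : Fin l.length}
    (hab : a ≠ b) :
    isobaric l[a].1 l[b].1 (keyWord l) =
      rename (fun k : Fin l.length => l[k].1) (isobaric a b (keyPoly fun k => l[k].2)) :=
  (rename_isobaric hab (fst_getElem_injective hl) _).symm

theorem isobaric_keyWord_of_le (A B : List (σ × ℕ)) (x y : σ) {p q : ℕ} (hpq : p ≤ q)
    (hl : ((A ++ (x, p) :: (y, q) :: B).map Prod.fst).Nodup) :
    isobaric x y (keyWord (A ++ (x, p) :: (y, q) :: B)) =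
      keyWord (A ++ (x, p) :: (y, q) :: B) := by
  have h := isobaric_keyWord hl (a := ⟨A.length, by simp⟩) (b := ⟨A.length + 1, by simp⟩) (by simp)
  rw [isobaric_keyPoly_of_le rfl (by simpa using hpq), ← keyWord] at h
  simpa using h

theorem keyWord_of_lt (A B : List (σ × ℕ)) (x y : σ) {p q : ℕ} (hpq : p < q)
    (hl : ((A ++ (x, q) :: (y, p) :: B).map Prod.fst).Nodup) :
    keyWord (A ++ (x, p) :: (y, q) :: B) =
      isobaric x y (keyWord (A ++ (x, q) :: (y, p) :: B)) := by
  set l := A ++ (x, q) :: (y, p) :: B with hl_def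
  let a : Fin l.length := ⟨A.length, by simp [l]⟩
  let b : Fin l.length := ⟨A.length + 1, by simp [l]⟩
  have ha : l[a] = (x, q) := by simp [a, l]
  have hb : l[b] = (y, p) := by simp [b, l]
  have h_swap : keyWord (A ++ (x, p) :: (y, q) :: B) =
      rename (fun k : Fin l.length => l[k].1) (keyPoly ((fun k => l[k].2) ∘ Equiv.swap a b)) := by
    refine keyWord_eq _ (by simp [l]) _ _ fun k => ?_
    rcases eq_or_ne k a with rfl | hka
    · simp only [Function.comp_apply, Equiv.swap_apply_left, ha, hb]
      simp [a]
    rcases eq_or_ne k b with rfl | hkb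
    · simp only [Function.comp_apply, Equiv.swap_apply_right, ha, hb]
      simp [b]
    have hkA : (k : ℕ) ≠ A.length := fun e => hka (Fin.ext e)
    have hk_succ : (k : ℕ) ≠ A.length + 1 := fun e => hkb (Fin.ext e)
    simp only [Function.comp_apply, Equiv.swap_apply_of_ne_of_ne hka hkb, hl_def, Fin.getElem_fin,
      List.getElem_append, List.getElem_cons]
    split_ifs <;> first | rfl | omega
  rw [h_swap, keyPoly_isKeyFamily.step _ a b rfl (by simpa [ha, hb] using hpq),
    ← isobaric_keyWord hl (by simp [a, b]), ha, hb]

end KeyWord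

section Sweep

variable {σ : Type*} [DecidableEq σ]

/-- The composite `ξ_{y_{N-1}, y_N} ⋯ ξ_{y_1, y_2} ξ_{y_0, y_1}` along a list of variables. -/
noncomputable def sweep : List σ → MvPolynomial σ ℚ → MvPolynomial σ ℚ
  | x :: y :: ys, f => sweep (y :: ys) (isobaric x y f)
  | _, f => f

theorem sweep_keyWord_of_sorted (A B : List (σ × ℕ)) (ys : List σ) (es : List ℕ)
    (hlen : ys.length = es.length) (hl : ((A ++ ys.zip es ++ B).map Prod.fst).Nodup)
    (hs : es.Pairwise (· ≤ ·)) :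
    sweep ys (keyWord (A ++ ys.zip es ++ B)) = keyWord (A ++ ys.zip es ++ B) := by
  induction ys generalizing A es with
  | nil => rfl
  | cons x ys ih =>
    rcases ys with _ | ⟨y, ys⟩
    · rfl
    rcases es with _ | ⟨p, _ | ⟨q, es⟩⟩
    · simp at hlen
    · simp at hlen
    have hA : A ++ (x :: y :: ys).zip (p :: q :: es) ++ B =
        (A ++ [(x, p)]) ++ (y :: ys).zip (q :: es) ++ B := by simp
    have hB : A ++ (x :: y :: ys).zip (p :: q :: es) ++ B =
        A ++ (x, p) :: (y, q) :: (ys.zip es ++ B) := by simp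
    have hpq : p ≤ q := (List.pairwise_cons.1 hs).1 q (by simp)
    rw [sweep, hB, isobaric_keyWord_of_le _ _ _ _ hpq (hB ▸ hl), ← hB, hA]
    exact ih _ _ (by simpa using hlen) (hA ▸ hl) hs.of_cons

theorem keyWord_orderedInsert (A B : List (σ × ℕ)) (y : σ) (ys : List σ) (p : ℕ) (es : List ℕ)
    (hlen : ys.length = es.length)
    (hl : ((A ++ (y :: ys).zip (p :: es) ++ B).map Prod.fst).Nodup)
    (hs : es.Pairwise (· ≤ ·)) :
    keyWord (A ++ (y :: ys).zip (es.orderedInsert (· ≤ ·) p) ++ B) =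
      sweep (y :: ys) (keyWord (A ++ (y :: ys).zip (p :: es) ++ B)) := by
  induction ys generalizing A y es with
  | nil =>
    obtain rfl : es = [] := by simpa using hlen.symm
    rfl
  | cons z ys ih =>
    rcases es with _ | ⟨q, es⟩
    · simp at hlen
    by_cases hpq : p ≤ q
    · have h_sorted : (p :: q :: es).Pairwise (· ≤ ·) :=
        List.pairwise_cons_cons_iff_of_trans.2 ⟨hpq, hs⟩
      rw [List.orderedInsert_cons_of_le _ _ hpq,
        sweep_keyWord_of_sorted _ _ _ _ (by simpa using hlen) hl h_sorted]
    have hA : A ++ (y :: z :: ys).zip (q :: es.orderedInsert (· ≤ ·) p) ++ B =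
        (A ++ [(y, q)]) ++ (z :: ys).zip (es.orderedInsert (· ≤ ·) p) ++ B := by simp
    have hqp : (A ++ [(y, q)]) ++ (z :: ys).zip (p :: es) ++ B =
        A ++ (y, q) :: (z, p) :: (ys.zip es ++ B) := by simp
    have hB : A ++ (y :: z :: ys).zip (p :: q :: es) ++ B =
        A ++ (y, p) :: (z, q) :: (ys.zip es ++ B) := by simp
    have hl' : (((A ++ [(y, q)]) ++ (z :: ys).zip (p :: es) ++ B).map Prod.fst).Nodup := by
      rw [hB] at hl
      simpa using hl
    rw [List.orderedInsert_of_not_le _ _ hpq, sweep, hA,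
      ih _ _ _ (by simpa using hlen) hl' hs.of_cons, hqp, hB,
      keyWord_of_lt _ _ _ _ (not_le.1 hpq) (hB ▸ hl)]

theorem sweep_sum_mul {κ : Type*} {ys : List σ} (hys : ys.Nodup) (s : Finset κ)
    {g : κ → MvPolynomial σ ℚ}
    (hg : ∀ k ∈ s, ∀ x ∈ ys, ∀ y ∈ ys, rename (Equiv.swap x y) (g k) = g k)
    (f : κ → MvPolynomial σ ℚ) :
    sweep ys (∑ k ∈ s, g k * f k) = ∑ k ∈ s, g k * sweep ys (f k) := by
  induction ys generalizing f with
  | nil => rfl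
  | cons x ys ih =>
    rcases ys with _ | ⟨y, ys⟩
    · rfl
    have hxy : x ≠ y := List.ne_of_not_mem_cons (List.nodup_cons.1 hys).1
    simp only [sweep]
    rw [isobaric_sum_mul hxy s fun k hk => hg k hk x (by simp) y (by simp)]
    exact ih hys.of_cons (fun k hk a ha b hb =>
      hg k hk a (List.mem_cons_of_mem _ ha) b (List.mem_cons_of_mem _ hb)) _

end Sweep

section Complete

variable {R : Type*} [CommRing R]

/-- The generating series `H(t) = ∏ 1 / (1 - x t)`, over the entries `x` of a list; its coefficients
are the complete homogeneous symmetric functions `h_m` of the entries. -/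
noncomputable def completeSeries (xs : List R) : PowerSeries R :=
  (xs.map fun x => PowerSeries.mk (x ^ ·)).prod

theorem completeSeries_cons (x : R) (xs : List R) :
    completeSeries (x :: xs) = PowerSeries.mk (x ^ ·) * completeSeries xs := by
  simp [completeSeries]

theorem coeff_zero_completeSeries (xs : List R) : (completeSeries xs).coeff 0 = 1 := by
  induction xs with
  | nil => simp [completeSeries]
  | cons x xs ih => simpa [completeSeries_cons] using ih

theorem derivative_mk_pow (x : R) :
    PowerSeries.derivative R (PowerSeries.mk (x ^ ·)) =
      PowerSeries.mk (fun k => x ^ (k + 1)) * PowerSeries.mk (x ^ ·) := by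
  ext m
  have h_term : ∀ k ∈ Finset.HasAntidiagonal.antidiagonal m,
      x ^ (k.1 + 1) * x ^ k.2 = x ^ (m + 1) := fun k hk => by
    rw [← pow_add, ← Finset.HasAntidiagonal.mem_antidiagonal.1 hk, add_right_comm]
  simp only [PowerSeries.coeff_derivative, PowerSeries.coeff_mul, PowerSeries.coeff_mk]
  rw [Finset.sum_congr rfl h_term]
  simp [mul_comm]

theorem derivative_completeSeries (xs : List R) :
    PowerSeries.derivative R (completeSeries xs) =
      PowerSeries.mk (fun k => (xs.map (· ^ (k + 1))).sum) * completeSeries xs := by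
  induction xs with
  | nil =>
    have h_zero : (PowerSeries.mk fun _ => 0 : PowerSeries R) = 0 := rfl
    simp [completeSeries, h_zero]
  | cons x xs ih =>
    have h_add : (PowerSeries.mk fun k => ((x :: xs).map (· ^ (k + 1))).sum) =
        PowerSeries.mk (fun k => x ^ (k + 1)) +
          PowerSeries.mk fun k => (xs.map (· ^ (k + 1))).sum := by
      ext
      simp
    rw [completeSeries_cons, Derivation.leibniz, ih, derivative_mk_pow, h_add, smul_eq_mul,
      smul_eq_mul]
    ring

theorem succ_mul_coeff_completeSeries (xs : List R) (m : ℕ) :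
    ((m + 1 : ℕ) : R) * (completeSeries xs).coeff (m + 1) =
      ∑ k ∈ Finset.range (m + 1),
        (xs.map (· ^ (k + 1))).sum * (completeSeries xs).coeff (m - k) := by
  have h := congrArg (PowerSeries.coeff m) (derivative_completeSeries xs)
  rw [PowerSeries.coeff_derivative, PowerSeries.coeff_mul,
    Finset.Nat.sum_antidiagonal_eq_sum_range_succ_mk] at h
  simpa [mul_comm] using h

theorem coeff_completeSeries_X {σ : Type*} [DecidableEq σ] {ys : List σ} (hys : ys.Nodup) (m : ℕ) :
    (completeSeries (ys.map X : List (MvPolynomial σ ℚ))).coeff m =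
      ∑ μ ∈ ys.toFinset.finsuppAntidiag m, monomial μ 1 := by
  rw [completeSeries, List.map_map, ← List.prod_toFinset _ hys, PowerSeries.coeff_prod]
  refine Finset.sum_congr rfl fun μ hμ => ?_
  rw [monomial_eq, C_1, one_mul,
    Finsupp.prod_of_support_subset _ (Finset.mem_finsuppAntidiag.1 hμ).2 _ (by simp)]
  simp

theorem sweep_X_pow {σ : Type*} [DecidableEq σ] (y : σ) (ys : List σ) (hys : (y :: ys).Nodup)
    (m : ℕ) :
    sweep (y :: ys) (X y ^ m) = (completeSeries ((y :: ys).map X)).coeff m := by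
  induction ys generalizing y m with
  | nil => simp [sweep, completeSeries]
  | cons z ys ih =>
    have hyz : y ≠ z := List.ne_of_not_mem_cons (List.nodup_cons.1 hys).1
    have h_fix : ∀ k ∈ Finset.range (m + 1), ∀ a ∈ z :: ys, ∀ b ∈ z :: ys,
        rename (Equiv.swap a b) (X y ^ k : MvPolynomial σ ℚ) = X y ^ k := by
      intro k _ a ha b hb
      have hya : y ≠ a := ne_of_mem_of_not_mem ha (List.nodup_cons.1 hys).1 |>.symm
      have hyb : y ≠ b := ne_of_mem_of_not_mem hb (List.nodup_cons.1 hys).1 |>.symm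
      rw [map_pow, rename_X, Equiv.swap_apply_of_ne_of_ne hya hyb]
    rw [sweep, isobaric_X_pow hyz, sweep_sum_mul hys.of_cons _ h_fix, List.map_cons,
      completeSeries_cons, PowerSeries.coeff_mul,
      Finset.Nat.sum_antidiagonal_eq_sum_range_succ_mk]
    simp only [ih _ hys.of_cons, PowerSeries.coeff_mk]

end Complete

section PowerSums

variable {ι σ : Type*}

/-- Evaluation of a polynomial in the power sums at finite alphabets: the variable `(i, k)`, which
stands for `p_k(X_i)`, is sent to `p_k` of the letters in the list `v i`. -/
noncomputable def evalPowerSums (v : ι → List σ) :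
    MvPolynomial (ι × ℕ+) ℚ →ₐ[ℚ] MvPolynomial σ ℚ :=
  aeval fun q => ((v q.1).map fun x => X x ^ (q.2 : ℕ)).sum

theorem evalPowerSums_X (v : ι → List σ) (q : ι × ℕ+) :
    evalPowerSums v (X q) = ((v q.1).map fun x => (X x : MvPolynomial σ ℚ) ^ (q.2 : ℕ)).sum :=
  aeval_X _ _

/-- The complete homogeneous symmetric function `h_m(X_j)` as a polynomial in the power sums,
obtained by solving Newton's identity. -/
noncomputable def completePS (j : ι) : ℕ → MvPolynomial (ι × ℕ+) ℚ
  | 0 => 1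
  | m + 1 => C (((m + 1 : ℕ) : ℚ)⁻¹) * ∑ k : Fin (m + 1), X (j, (k : ℕ).succPNat) *
      completePS j (m - k)
termination_by m => m
decreasing_by omega

theorem evalPowerSums_completePS (v : ι → List σ) (j : ι) (m : ℕ) :
    evalPowerSums v (completePS j m) = (completeSeries ((v j).map X)).coeff m := by
  induction m using Nat.strong_induction_on with
  | _ m ih =>
    rcases m with _ | m
    · rw [completePS, map_one, coeff_zero_completeSeries]
    have h_newton : evalPowerSums v
          (∑ k : Fin (m + 1), X (j, (k : ℕ).succPNat) * completePS j (m - k)) =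
        ((m + 1 : ℕ) : MvPolynomial σ ℚ) * (completeSeries ((v j).map X)).coeff (m + 1) := by
      rw [succ_mul_coeff_completeSeries, Finset.sum_range, map_sum]
      refine Finset.sum_congr rfl fun k _ => ?_
      rw [map_mul, ih (m - k) (by omega), evalPowerSums_X, List.map_map]
      rfl
    rw [completePS, map_mul, h_newton, algHom_C, algebraMap_eq, ← mul_assoc, ← map_natCast C,
      ← C_mul, inv_mul_cancel₀ (by positivity), C_1, one_mul]

/-- The expansion of `f(X_1 + c_1 w | X_2 + c_2 w | ⋯)` in powers of a variable `w`, for a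
polynomial `f` in the power sums. -/
noncomputable def shiftPoly (c : ι → ℤ) :
    MvPolynomial (ι × ℕ+) ℚ →ₐ[ℚ] Polynomial (MvPolynomial (ι × ℕ+) ℚ) :=
  aeval fun q => Polynomial.C (X q) + c q.1 • Polynomial.X ^ (q.2 : ℕ)

theorem eval₂_shiftPoly {A : Type*} [CommRing A] [Algebra ℚ A] {c : ι → ℤ} {x : A}
    {φ ψ : MvPolynomial (ι × ℕ+) ℚ →ₐ[ℚ] A}
    (h : ∀ q, ψ (X q) = φ (X q) + c q.1 • x ^ (q.2 : ℕ)) (f : MvPolynomial (ι × ℕ+) ℚ) :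
    (shiftPoly c f).eval₂ (φ : MvPolynomial (ι × ℕ+) ℚ →+* A) x = ψ f := by
  have h_comp : (Polynomial.eval₂AlgHom φ x fun _ => .all _ _).comp (shiftPoly c) = ψ :=
    algHom_ext fun q => by
      rw [AlgHom.comp_apply, shiftPoly, aeval_X, map_add, map_zsmul, map_pow, h]
      simp
  exact DFunLike.congr_fun h_comp f

/-- The operator `g ↦ ⟨z⁰⟩ g(z⁻¹) Ω(z X_j)` on polynomials `g` over the ring of power sums. -/
noncomputable def constTermOmega (j : ι) (g : Polynomial (MvPolynomial (ι × ℕ+) ℚ)) :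
    MvPolynomial (ι × ℕ+) ℚ :=
  g.sum fun m c => c * completePS j m

/-- The operator `f ↦ ⟨z⁰⟩ f(⋯ | X_i + z⁻¹ | ⋯ | X_j - z⁻¹ | ⋯) Ω(z X_j)` on polynomials in the
power sums. -/
noncomputable def moveOp [DecidableEq ι] (i j : ι) (f : MvPolynomial (ι × ℕ+) ℚ) :
    MvPolynomial (ι × ℕ+) ℚ :=
  constTermOmega j (shiftPoly (Pi.single i 1 - Pi.single j 1) f)

end PowerSums

section AlphabetFamily

variable {ι σ : Type*}

/-- Finite alphabets without repetitions and without common letters. -/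
structure IsAlphabetFamily (v : ι → List σ) : Prop where
  nodup (i : ι) : (v i).Nodup
  disjoint : Pairwise fun i j => (v i).Disjoint (v j)

theorem IsAlphabetFamily.nodup_flatMap {v : ι → List σ} (hv : IsAlphabetFamily v) {bs : List ι}
    (hbs : bs.Nodup) : (bs.flatMap v).Nodup :=
  List.nodup_flatMap.2 ⟨fun i _ => hv.nodup i, hbs.imp fun hij => hv.disjoint hij⟩

theorem IsAlphabetFamily.rename_swap_evalPowerSums [DecidableEq σ] {v : ι → List σ} {j : ι}
    (hv : IsAlphabetFamily v) {x y : σ} (hx : x ∈ v j) (hy : y ∈ v j)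
    (f : MvPolynomial (ι × ℕ+) ℚ) :
    rename (Equiv.swap x y) (evalPowerSums v f) = evalPowerSums v f := by
  have h_mem : ∀ l, ∀ a ∈ v l, Equiv.swap x y a ∈ v l := fun l a ha => by
    rcases eq_or_ne l j with rfl | hl
    · rw [Equiv.swap_apply_def]
      split_ifs <;> assumption
    · have hne : ∀ b ∈ v j, a ≠ b := fun b hb => by
        rintro rfl
        exact hv.disjoint hl ha hb
      rwa [Equiv.swap_apply_of_ne_of_ne (hne x hx) (hne y hy)]
  have h_perm : ∀ l, ((v l).map (Equiv.swap x y)).Perm (v l) := fun l =>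
    (((hv.nodup l).map (Equiv.swap x y).injective).subperm
      (List.forall_mem_map.2 (h_mem l))).perm_of_length_le (by simp)
  have h_comp : (rename (Equiv.swap x y)).comp (evalPowerSums v) = evalPowerSums v := by
    refine algHom_ext fun q => ?_
    simpa [evalPowerSums_X, map_list_sum, Function.comp_def] using
      ((h_perm q.1).map fun a => (X a : MvPolynomial σ ℚ) ^ (q.2 : ℕ)).sum_eq
  exact DFunLike.congr_fun h_comp f

variable [DecidableEq ι] {v : ι → List σ} {i j : ι} {y : σ} {ys : List σ}

theorem IsAlphabetFamily.drop (hv : IsAlphabetFamily v) (hj : v j = y :: ys) :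
    IsAlphabetFamily (Function.update v j ys) := by
  have h_sub : ∀ l, (Function.update v j ys l).Sublist (v l) := fun l => by
    rcases eq_or_ne l j with rfl | hl
    · simp [hj]
    · simp [hl]
  exact ⟨fun l => (hv.nodup l).sublist (h_sub l), fun k l hkl _ hk hl =>
    hv.disjoint hkl ((h_sub k).subset hk) ((h_sub l).subset hl)⟩

theorem IsAlphabetFamily.transfer (hv : IsAlphabetFamily v) (hij : i ≠ j) (hj : v j = y :: ys) :
    IsAlphabetFamily (Function.update (Function.update v j ys) i (v i ++ [y])) := by
  have hy : ∀ l, l ≠ j → y ∉ v l := fun l hl hyl => hv.disjoint hl hyl (by simp [hj])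
  have hw := hv.drop hj
  set w := Function.update v j ys with hw_def
  have hi : w i = v i := by simp [w, hij]
  have hyw : ∀ l, y ∉ w l := fun l => by
    rcases eq_or_ne l j with rfl | hl
    · simpa [w] using (List.nodup_cons.1 (hj ▸ hv.nodup l)).1
    · simpa [w, hl] using hy l hl
  have h_disj : ∀ l, i ≠ l → (v i ++ [y]).Disjoint (w l) := fun l hl => by
    simpa [hyw l, ← hi] using hw.disjoint hl
  refine ⟨fun l => ?_, fun k l hkl => ?_⟩
  · rcases eq_or_ne l i with rfl | hl
    · simpa [List.nodup_append, hv.nodup l] using fun a ha => ne_of_mem_of_not_mem ha (hy l hij)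
    · simpa [hl] using hw.nodup l
  · rcases eq_or_ne k i with rfl | hk
    · simpa [hkl.symm] using h_disj l hkl
    rcases eq_or_ne l i with rfl | hl
    · simpa [hk] using (h_disj k hkl.symm).symm
    · simpa [hk, hl] using hw.disjoint hkl

end AlphabetFamily

section Words

/-- The composition `0^{n - ℓ(s)} * rev(s)`, for `n ≥ ℓ(s)`. -/
def padded (s : Multiset ℕ) (n : ℕ) : List ℕ :=
  (s + Multiset.replicate (n - s.card) 0).sort (· ≤ ·)

theorem length_padded {s : Multiset ℕ} {n : ℕ} (h : s.card ≤ n) : (padded s n).length = n := by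
  simp [padded, h]

theorem pairwise_padded (s : Multiset ℕ) (n : ℕ) : (padded s n).Pairwise (· ≤ ·) :=
  Multiset.pairwise_sort _ _

theorem coe_padded (s : Multiset ℕ) (n : ℕ) :
    (padded s n : Multiset ℕ) = s + Multiset.replicate (n - s.card) 0 :=
  Multiset.sort_eq _ _

theorem mem_padded {s : Multiset ℕ} {n a : ℕ} (h : a ∈ padded s n) : a ∈ s ∨ a = 0 := by
  rw [← Multiset.mem_coe, coe_padded, Multiset.mem_add] at h
  exact h.imp_right Multiset.eq_of_mem_replicate

theorem eq_padded {s : Multiset ℕ} {n : ℕ} {l : List ℕ} (hl : l.Pairwise (· ≤ ·))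
    (h : (l : Multiset ℕ) = s + Multiset.replicate (n - s.card) 0) : l = padded s n := by
  refine List.Perm.eq_of_pairwise' hl (pairwise_padded s n) ?_
  rw [← Multiset.coe_eq_coe, h, coe_padded]

theorem orderedInsert_padded (s : Multiset ℕ) (n p : ℕ) :
    (padded s n).orderedInsert (· ≤ ·) p = padded (s + {p}) (n + 1) := by
  refine eq_padded ((pairwise_padded s n).orderedInsert p _) ?_
  rw [Multiset.coe_eq_coe.2 (List.perm_orderedInsert _ p _), ← Multiset.cons_coe, coe_padded,
    Multiset.card_add, Multiset.card_singleton, Nat.add_sub_add_right, ← Multiset.singleton_add]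
  abel

theorem padded_add_of_forall_le {s : Multiset ℕ} {p : ℕ} (n : ℕ) (h : ∀ x ∈ s, x ≤ p) :
    padded (s + {p}) (n + 1) = padded s n ++ [p] := by
  refine (eq_padded (List.pairwise_append.2
    ⟨pairwise_padded s n, List.pairwise_singleton _ _, fun a ha b hb => ?_⟩) ?_).symm
  · rw [List.mem_singleton.1 hb]
    exact (mem_padded ha).elim (h a) fun ha => ha ▸ p.zero_le
  · rw [← Multiset.coe_add, coe_padded, Multiset.coe_singleton, Multiset.card_add,
      Multiset.card_singleton, Nat.add_sub_add_right]
    abel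

variable {ι σ : Type*}

/-- The part of a word that belongs to one alphabet: the letters `xs`, with exponents
`0^{n - ℓ(s)} * rev(s)`. -/
def block (xs : List σ) (s : Multiset ℕ) : List (σ × ℕ) := xs.zip (padded s xs.length)

/-- The concatenation of the blocks with letters `v i` and parts `lam i`, for `i` in `bs`. -/
def word (bs : List ι) (v : ι → List σ) (lam : ι → Multiset ℕ) : List (σ × ℕ) :=
  bs.flatMap fun i => block (v i) (lam i)

theorem map_fst_block {xs : List σ} {s : Multiset ℕ} (h : s.card ≤ xs.length) :
    (block xs s).map Prod.fst = xs :=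
  List.map_fst_zip (length_padded h).ge

theorem block_concat {xs : List σ} {s : Multiset ℕ} {p : ℕ} (hs : s.card ≤ xs.length)
    (hp : ∀ a ∈ s, a ≤ p) (y : σ) :
    block (xs ++ [y]) (s + {p}) = block xs s ++ [(y, p)] := by
  rw [block, List.length_append, List.length_singleton, padded_add_of_forall_le _ hp,
    List.zip_append (length_padded hs).symm]
  rfl

theorem snd_mem_of_mem_block {xs : List σ} {s : Multiset ℕ} {w : σ × ℕ} (hw : w ∈ block xs s) :
    w.2 ∈ s ∨ w.2 = 0 :=
  mem_padded (List.of_mem_zip hw).2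

theorem map_fst_word {bs : List ι} {v : ι → List σ} {lam : ι → Multiset ℕ}
    (h : ∀ l ∈ bs, (lam l).card ≤ (v l).length) : (word bs v lam).map Prod.fst = bs.flatMap v := by
  rw [word, List.map_flatMap]
  exact List.flatMap_congr fun i hi => map_fst_block (h i hi)

theorem snd_mem_of_mem_word {bs : List ι} {v : ι → List σ} {lam : ι → Multiset ℕ} {w : σ × ℕ}
    (hw : w ∈ word bs v lam) : (∃ l ∈ bs, w.2 ∈ lam l) ∨ w.2 = 0 := by
  obtain ⟨l, hl, hw⟩ := List.mem_flatMap.1 hw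
  exact (snd_mem_of_mem_block hw).imp_left fun h => ⟨l, hl, h⟩

theorem word_congr {bs : List ι} {v v' : ι → List σ} {lam lam' : ι → Multiset ℕ}
    (hv : ∀ l ∈ bs, v l = v' l) (hlam : ∀ l ∈ bs, lam l = lam' l) :
    word bs v lam = word bs v' lam' :=
  List.flatMap_congr fun l hl => by rw [hv l hl, hlam l hl]

theorem word_nil (v : ι → List σ) (lam : ι → Multiset ℕ) : word [] v lam = [] :=
  rfl

theorem word_append (A B : List ι) (v : ι → List σ) (lam : ι → Multiset ℕ) :
    word (A ++ B) v lam = word A v lam ++ word B v lam :=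
  List.flatMap_append

theorem word_cons (i : ι) (B : List ι) (v : ι → List σ) (lam : ι → Multiset ℕ) :
    word (i :: B) v lam = block (v i) (lam i) ++ word B v lam :=
  List.flatMap_cons

end Words

section Represents

variable {ι σ : Type*} {v : ι → List σ}

/-- `f` expresses in power sums the key polynomial with blocks `bs` and parts `lam`, uniformly in
the alphabets. The alphabets have to be large enough for `padded` to make sense. -/
def Represents (σ : Type*) (bs : List ι) (lam : ι → Multiset ℕ) (f : MvPolynomial (ι × ℕ+) ℚ) :
    Prop :=
  ∀ v : ι → List σ, IsAlphabetFamily v → (∀ l ∈ bs, (lam l).card ≤ (v l).length) →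
    keyWord (word bs v lam) = evalPowerSums v f

theorem IsAlphabetFamily.sweep_eval₂ [DecidableEq σ] (hv : IsAlphabetFamily v) {j : ι} {y : σ}
    {ys : List σ} (hj : v j = y :: ys) (g : Polynomial (MvPolynomial (ι × ℕ+) ℚ)) :
    sweep (y :: ys)
        (g.eval₂ (evalPowerSums v : MvPolynomial (ι × ℕ+) ℚ →+* MvPolynomial σ ℚ) (X y)) =
      evalPowerSums v (constTermOmega j g) := by
  have h_nodup : (y :: ys).Nodup := hj ▸ hv.nodup j
  rw [Polynomial.eval₂_eq_sum, Polynomial.sum, sweep_sum_mul h_nodup, constTermOmega,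
    Polynomial.sum, map_sum]
  · refine Finset.sum_congr rfl fun m _ => ?_
    rw [map_mul, evalPowerSums_completePS, hj, ← sweep_X_pow y ys h_nodup, RingHom.coe_coe]
  · rw [← hj]
    exact fun m _ a ha b hb => hv.rename_swap_evalPowerSums ha hb _

variable [DecidableEq ι] {lam : ι → Multiset ℕ} {p : ℕ}

theorem IsAlphabetFamily.keyWord_word_add_single (hv : IsAlphabetFamily v) {A B : List ι} {j : ι}
    (hbs : (A ++ j :: B).Nodup) {y : σ} {ys : List σ} (hj : v j = y :: ys)
    (hlen : ∀ l ∈ A ++ j :: B, ((lam + Pi.single j {p} : ι → Multiset ℕ) l).card ≤ (v l).length)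
    {g : Polynomial (MvPolynomial (ι × ℕ+) ℚ)}
    (hg : keyWord (word A v lam ++ (y, p) :: block ys (lam j) ++ word B v lam) =
      g.eval₂ (evalPowerSums v : MvPolynomial (ι × ℕ+) ℚ →+* MvPolynomial σ ℚ) (X y)) :
    keyWord (word (A ++ j :: B) v (lam + Pi.single j {p})) =
      evalPowerSums v (constTermOmega j g) := by
  classical
  have hj_card : (lam j).card ≤ ys.length := by simpa [hj] using hlen j (by simp)
  have h_congr : ∀ C : List ι, j ∉ C →
      word C v (lam + Pi.single j {p} : ι → Multiset ℕ) = word C v lam := fun C hC =>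
    word_congr (fun _ _ => rfl) fun l hl => by simp [ne_of_mem_of_not_mem hl hC]
  have h_nodup := List.nodup_append.1 hbs
  have hA := h_congr A fun h => h_nodup.2.2 j h j (by simp) rfl
  have hB := h_congr B (List.nodup_cons.1 h_nodup.2.1).1
  have h_word : word (A ++ j :: B) v (lam + Pi.single j {p}) = word A v lam ++
      (y :: ys).zip ((padded (lam j) ys.length).orderedInsert (· ≤ ·) p) ++ word B v lam := by
    rw [word_append, word_cons, hA, hB, hj, orderedInsert_padded, block]
    simp
  have h_letters : ((word A v lam ++ (y :: ys).zip (p :: padded (lam j) ys.length) ++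
      word B v lam).map Prod.fst).Nodup := by
    have h := hv.nodup_flatMap hbs
    rw [← map_fst_word hlen, h_word, List.map_append, List.map_append,
      List.map_fst_zip (by simp [List.orderedInsert_length, length_padded hj_card])] at h
    rwa [List.map_append, List.map_append,
      List.map_fst_zip (by simp [length_padded hj_card])]
  rw [h_word, keyWord_orderedInsert _ _ _ _ _ _ (length_padded hj_card).symm h_letters
    (pairwise_padded _ _), ← hv.sweep_eval₂ hj, ← hg]
  rfl

theorem eval₂_shiftPoly_drop {j : ι} {y : σ} {ys : List σ} (hj : v j = y :: ys)
    (f : MvPolynomial (ι × ℕ+) ℚ) :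
    (shiftPoly (-Pi.single j 1) f).eval₂
        (evalPowerSums v : MvPolynomial (ι × ℕ+) ℚ →+* MvPolynomial σ ℚ) (X y) =
      evalPowerSums (Function.update v j ys) f := by
  refine eval₂_shiftPoly (fun q => ?_) f
  rw [evalPowerSums_X, evalPowerSums_X]
  rcases eq_or_ne q.1 j with hq | hq
  · simp [hq, hj]
  · simp [hq]

theorem eval₂_shiftPoly_transfer {i j : ι} (hij : i ≠ j) {y : σ} {ys : List σ}
    (hj : v j = y :: ys) (f : MvPolynomial (ι × ℕ+) ℚ) :
    (shiftPoly (Pi.single i 1 - Pi.single j 1) f).eval₂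
        (evalPowerSums v : MvPolynomial (ι × ℕ+) ℚ →+* MvPolynomial σ ℚ) (X y) =
      evalPowerSums (Function.update (Function.update v j ys) i (v i ++ [y])) f := by
  refine eval₂_shiftPoly (fun q => ?_) f
  rw [evalPowerSums_X, evalPowerSums_X]
  rcases eq_or_ne q.1 i with hi | hi
  · simp [hi, hij]
  rcases eq_or_ne q.1 j with hq | hq
  · simp [hq, hj, hij.symm]
  · simp [hi, hq]

theorem word_transfer {A B : List ι} {i j : ι} (hbs : (A ++ [i, j] ++ B).Nodup)
    (hi : (lam i).card ≤ (v i).length) (hp : ∀ x ∈ lam i, x ≤ p) (y : σ) (ys : List σ) :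
    word (A ++ [i, j] ++ B) (Function.update (Function.update v j ys) i (v i ++ [y]))
        (lam + Pi.single i {p}) =
      word (A ++ [i]) v lam ++ (y, p) :: block ys (lam j) ++ word B v lam := by
  obtain ⟨hij, hiA, hjA, hiB, hjB⟩ : i ≠ j ∧ i ∉ A ∧ j ∉ A ∧ i ∉ B ∧ j ∉ B := by
    simp only [List.nodup_append, List.nodup_cons] at hbs
    grind
  have h_congr : ∀ C : List ι, i ∉ C → j ∉ C →
      word C (Function.update (Function.update v j ys) i (v i ++ [y])) (lam + Pi.single i {p}) =
        word C v lam := fun C hiC hjC =>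
    word_congr
      (fun l hl => by simp [ne_of_mem_of_not_mem hl hiC, ne_of_mem_of_not_mem hl hjC])
      fun l hl => by simp [ne_of_mem_of_not_mem hl hiC]
  simp [word_append, word_cons, word_nil, h_congr A hiA hjA, h_congr B hiB hjB, hij.symm,
    block_concat hi hp]

theorem Represents.move {bs : List ι} (hbs : bs.Nodup) {i j : ι} (hij : [i, j] <:+: bs)
    (hp : ∀ x ∈ lam i, x ≤ p) {f : MvPolynomial (ι × ℕ+) ℚ}
    (hf : Represents σ bs (lam + Pi.single i {p}) f) :
    Represents σ bs (lam + Pi.single j {p}) (moveOp i j f) := by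
  obtain ⟨A, B, rfl⟩ := hij
  intro v hv hlen
  have h_ne : i ≠ j := by
    rintro rfl
    simp [List.nodup_append] at hbs
  have h_pos : (lam j).card + 1 ≤ (v j).length := by simpa using hlen j (by simp)
  obtain ⟨y, ys, hj⟩ := List.exists_cons_of_length_pos (Nat.zero_lt_of_lt h_pos)
  have hi : (lam i).card ≤ (v i).length := by simpa [h_ne] using hlen i (by simp)
  have h_card : ∀ l ∈ A ++ [i, j] ++ B, ((lam + Pi.single i {p} : ι → Multiset ℕ) l).card ≤
      (Function.update (Function.update v j ys) i (v i ++ [y]) l).length := fun l hl => by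
    rcases eq_or_ne l i with rfl | hli
    · simpa using hi
    rcases eq_or_ne l j with rfl | hlj
    · simpa [hj, hli] using hlen l hl
    · simpa [hli, hlj] using hlen l hl
  have h_bs : A ++ [i, j] ++ B = (A ++ [i]) ++ j :: B := by simp
  rw [h_bs] at hlen ⊢
  refine hv.keyWord_word_add_single (h_bs ▸ hbs) hj hlen ?_
  rw [eval₂_shiftPoly_transfer h_ne hj, ← hf _ (hv.transfer h_ne hj) h_card,
    word_transfer hbs hi hp]

theorem Represents.insert_head {j : ι} {B : List ι} (hbs : (j :: B).Nodup)
    (hp : ∀ l ∈ j :: B, ∀ x ∈ lam l, x ≤ p) {f : MvPolynomial (ι × ℕ+) ℚ}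
    (hf : Represents σ (j :: B) lam f) :
    Represents σ (j :: B) (lam + Pi.single j {p})
      (constTermOmega j (Polynomial.X ^ p * shiftPoly (-Pi.single j 1) f)) := by
  intro v hv hlen
  have h_pos : (lam j).card + 1 ≤ (v j).length := by simpa using hlen j (by simp)
  obtain ⟨y, ys, hj⟩ := List.exists_cons_of_length_pos (Nat.zero_lt_of_lt h_pos)
  have h_card : ∀ l ∈ j :: B, (lam l).card ≤ (Function.update v j ys l).length := fun l hl => by
    rcases eq_or_ne l j with rfl | hlj
    · simpa [hj] using hlen l hl
    · simpa [hlj] using hlen l hl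
  have h_word : word (j :: B) (Function.update v j ys) lam =
      block ys (lam j) ++ word B v lam := by
    rw [word_cons, Function.update_self, word_congr (fun l hl => Function.update_of_ne
      (ne_of_mem_of_not_mem hl (List.nodup_cons.1 hbs).1) _ _) fun _ _ => rfl]
  have h_le : ∀ w ∈ block ys (lam j) ++ word B v lam, w.2 ≤ p := fun w hw => by
    rcases snd_mem_of_mem_word (h_word ▸ hw) with ⟨l, hl, hw⟩ | hw
    · exact hp l hl _ hw
    · exact hw ▸ p.zero_le
  refine hv.keyWord_word_add_single (A := []) hbs hj hlen ?_
  rw [Polynomial.eval₂_mul, Polynomial.eval₂_X_pow, eval₂_shiftPoly_drop hj,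
    ← hf _ (hv.drop hj) h_card, h_word]
  exact keyWord_cons_of_forall_le h_le

theorem getElem_pair_infix {α : Type*} {l : List α} {k : ℕ} (hk : k + 1 < l.length) :
    [l[k], l[k + 1]] <:+: l :=
  ⟨l.take k, l.drop (k + 2), by
    rw [List.append_assoc, List.cons_append, List.singleton_append, ← List.drop_eq_getElem_cons,
      ← List.drop_eq_getElem_cons, List.take_append_drop]⟩

/-- A part that dominates all others is inserted into the first block and carried to the `k`-th. -/
theorem exists_represents_add_single {bs : List ι} (hbs : bs.Nodup)
    (hp : ∀ l ∈ bs, ∀ x ∈ lam l, x ≤ p) (h : ∃ f, Represents σ bs lam f) {k : ℕ}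
    (hk : k < bs.length) : ∃ f, Represents σ bs (lam + Pi.single bs[k] {p}) f := by
  induction k with
  | zero =>
    obtain ⟨f, hf⟩ := h
    obtain ⟨j, B, rfl⟩ := List.exists_cons_of_length_pos hk
    exact ⟨_, hf.insert_head hbs hp⟩
  | succ k ih =>
    obtain ⟨f, hf⟩ := ih (by omega)
    exact ⟨_, hf.move hbs (getElem_pair_infix hk) (hp _ (List.getElem_mem _))⟩

theorem update_erase_add_single {d : ι} (hp : p ∈ lam d) :
    Function.update lam d ((lam d).erase p) + Pi.single d {p} = lam := by
  funext l
  rcases eq_or_ne l d with rfl | hl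
  · simpa [add_comm _ {p}] using Multiset.cons_erase hp
  · simp [hl]

theorem sup_mem_of_ne_zero {s : Multiset ℕ} (hs : s ≠ 0) : s.sup ∈ s := by
  obtain ⟨a, ha, h_max⟩ := s.exists_max_image id hs
  rwa [(Multiset.sup_le.2 h_max).antisymm (Multiset.le_sup ha)]

end Represents

theorem exists_represents {ι σ : Type*} {bs : List ι} (hbs : bs.Nodup) (lam : ι → Multiset ℕ) :
    ∃ f, Represents σ bs lam f := by
  classical
  induction h : ((bs : Multiset ι).bind lam).card using Nat.strong_induction_on
    generalizing lam with
  | _ n ih =>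
    subst h
    rcases eq_or_ne ((bs : Multiset ι).bind lam) 0 with h_zero | h_zero
    · refine ⟨1, fun v _ _ => ?_⟩
      rw [map_one]
      refine keyWord_eq_one fun w hw => (snd_mem_of_mem_word hw).resolve_left ?_
      rintro ⟨l, hl, hw⟩
      exact Multiset.eq_zero_iff_forall_notMem.1 h_zero _ (Multiset.mem_bind.2 ⟨l, hl, hw⟩)
    obtain ⟨d, hd, hpd⟩ := Multiset.mem_bind.1 (sup_mem_of_ne_zero h_zero)
    set p := ((bs : Multiset ι).bind lam).sup
    set lam' := Function.update lam d ((lam d).erase p) with hlam'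
    have h_le : lam' ≤ lam := by
      rw [hlam', update_le_self_iff]
      exact Multiset.erase_le _ _
    have h_lt : ((bs : Multiset ι).bind lam').card < ((bs : Multiset ι).bind lam).card := by
      simp only [Multiset.card_bind, Multiset.map_coe, Multiset.sum_coe]
      refine List.sum_lt_sum _ _ (fun l _ => Multiset.card_le_card (h_le l)) ⟨d, hd, ?_⟩
      simpa [lam'] using Multiset.card_erase_lt_of_mem hpd
    obtain ⟨k, hk, rfl⟩ := List.getElem_of_mem hd
    rw [← update_erase_add_single hpd]
    refine exists_represents_add_single hbs (fun l hl x hx => ?_) (ih _ h_lt _ rfl) hk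
    exact Multiset.le_sup (Multiset.mem_bind.2 ⟨l, hl, Multiset.mem_of_le (h_le l) hx⟩)

section Concatenation

theorem getElem?_flatMap_finRange {α : Type*} {r : ℕ} {n : Fin r → ℕ} {g : Fin r → List α}
    (hg : ∀ i, (g i).length = n i) (i : Fin r) (k : Fin (n i)) :
    ((List.finRange r).flatMap g)[(finSigmaFinEquiv ⟨i, k⟩ : ℕ)]? = (g i)[(k : ℕ)]? := by
  rw [finSigmaFinEquiv_apply]
  induction r with
  | zero => exact i.elim0
  | succ r ih =>
    rw [List.finRange_succ, List.flatMap_cons, List.flatMap_map]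
    cases i using Fin.cases with
    | zero =>
      have h_sum : ∑ c : Fin ((0 : Fin (r + 1)) : ℕ), n (Fin.castLE (0 : Fin (r + 1)).2.le c) = 0 :=
        Fintype.sum_empty (ι := Fin 0) _
      rw [h_sum, zero_add, List.getElem?_append_left (by rw [hg]; exact k.2)]
    | succ i =>
      have h_sum : ∑ c : Fin (i.succ : Fin (r + 1)), n (Fin.castLE i.succ.2.le c) =
          n 0 + ∑ c : Fin i, n (Fin.castLE i.2.le c).succ :=
        Fin.sum_univ_succ (n := i) fun c => n (Fin.castLE i.succ.2.le c)
      rw [h_sum, add_assoc, List.getElem?_append_right (by rw [hg]; omega), hg,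
        Nat.add_sub_cancel_left]
      exact ih (fun c => hg c.succ) i k

theorem padded_eq_append (s : Multiset ℕ) (n : ℕ) :
    padded s n = List.replicate (n - s.card) 0 ++ (s.sort (· ≥ ·)).reverse := by
  refine (eq_padded (List.pairwise_append.2
    ⟨List.pairwise_replicate.2 (.inr le_rfl), ?_, fun a ha b _ => ?_⟩) ?_).symm
  · exact List.pairwise_reverse.2 (Multiset.pairwise_sort s (· ≥ ·))
  · exact List.eq_of_mem_replicate ha ▸ b.zero_le
  · rw [← Multiset.coe_add, Multiset.coe_reverse, Multiset.sort_eq, Multiset.coe_replicate,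
      add_comm]

theorem getElem?_padded (lam : Par) {n : ℕ} (h : lam.2.parts.card ≤ n) (k : Fin n) :
    (padded lam.2.parts n)[(k : ℕ)]? = some (lam.revPad n k) := by
  have hk := k.2
  have h_len := Multiset.length_sort (s := lam.2.parts) (r := (· ≥ ·))
  rw [padded_eq_append, Par.revPad]
  by_cases hlt : (k : ℕ) < n - lam.2.parts.card
  · rw [List.getElem?_append_left (by simpa using hlt), List.getElem?_replicate, if_pos hlt,
      List.getD_eq_default _ _ (by omega)]
  · rw [List.getElem?_append_right (by simpa using hlt), List.length_replicate,
      List.getElem?_reverse (by omega), h_len, List.getD_eq_getElem _ _ (by omega),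
      List.getElem?_eq_getElem (by omega)]
    congr 2
    omega

theorem length_block {σ : Type*} {xs : List σ} {s : Multiset ℕ} (h : s.card ≤ xs.length) :
    (block xs s).length = xs.length := by
  rw [block, List.length_zip, length_padded h, min_self]

variable {r : ℕ}

/-- The initial segments `x_{i,0}, …, x_{i,n_i-1}` of the infinite alphabets. -/
def alphabets (n : Fin r → ℕ) (i : Fin r) : List (Fin r × ℕ) :=
  (List.range (n i)).map (Prod.mk i)

theorem length_alphabets (n : Fin r → ℕ) (i : Fin r) : (alphabets n i).length = n i := by
  simp [alphabets]

theorem isAlphabetFamily_alphabets (n : Fin r → ℕ) : IsAlphabetFamily (alphabets n) where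
  nodup i := List.nodup_range.map (Prod.mk_right_injective i)
  disjoint i j hij := by
    simpa [alphabets, List.disjoint_left] using fun _ _ _ _ h => absurd h.symm hij

theorem multiSchurPoly_eq_keyWord (lam : Fin r → Par) {n : Fin r → ℕ}
    (h : ∀ l, (lam l).2.parts.card ≤ n l) :
    multiSchurPoly lam n =
      keyWord (word (List.finRange r) (alphabets n) fun l => (lam l).2.parts) := by
  have h_block : ∀ i, (block (alphabets n i) (lam i).2.parts).length = n i := fun i => by
    rw [length_block (by rw [length_alphabets]; exact h i), length_alphabets]
  have h_length : (word (List.finRange r) (alphabets n) fun l => (lam l).2.parts).length =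
      ∑ i, n i := by
    simp only [word, List.length_flatMap, h_block, ← List.ofFn_eq_map, List.sum_ofFn]
  refine (keyWord_eq _ h_length _ _ fun k => ?_).symm
  obtain ⟨⟨i, k⟩, rfl⟩ := finSigmaFinEquiv.surjective k
  refine (List.getElem_eq_iff _).2 ?_
  rw [Equiv.symm_apply_apply, word, getElem?_flatMap_finRange h_block, block,
    List.getElem?_zip_eq_some, length_alphabets]
  exact ⟨by simp [alphabets], getElem?_padded (lam i) (h i) k⟩

end Concatenation

section Truncation

variable {r : ℕ}

theorem rename_evalPowerSums {ι σ τ : Type*} (g : σ → τ) (v : ι → List σ)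
    (f : MvPolynomial (ι × ℕ+) ℚ) :
    rename g (evalPowerSums v f) = evalPowerSums (fun l => (v l).map g) f := by
  have h_comp : (rename g).comp (evalPowerSums v) = evalPowerSums fun l => (v l).map g :=
    algHom_ext fun q => by simp [evalPowerSums_X, map_list_sum, Function.comp_def]
  exact DFunLike.congr_fun h_comp f

/-- The inclusion of the variables of finite alphabets of sizes `n_1, …, n_r` into those of the
infinite alphabets. -/
def sigmaEmbedding (n : Fin r → ℕ) : (Σ l, Fin (n l)) ↪ Fin r × ℕ where
  toFun v := (v.1, v.2)
  inj' := by
    rintro ⟨l, a⟩ ⟨l', a'⟩ h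
    obtain ⟨rfl, h⟩ := Prod.mk.inj h
    exact congrArg _ (Fin.ext h)

theorem mem_range_sigmaEmbedding {n : Fin r → ℕ} {v : Fin r × ℕ} :
    v ∈ Set.range (sigmaEmbedding n) ↔ v.2 < n v.1 :=
  ⟨by rintro ⟨a, rfl⟩; exact a.2.2, fun h => ⟨⟨v.1, v.2, h⟩, rfl⟩⟩

/-- The letters of finite alphabets of sizes `n_1, …, n_r`. -/
def sigmaAlphabets (n : Fin r → ℕ) (l : Fin r) : List (Σ l, Fin (n l)) :=
  (List.finRange (n l)).map (Sigma.mk l)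

theorem map_sigmaEmbedding_sigmaAlphabets (n : Fin r → ℕ) (l : Fin r) :
    (sigmaAlphabets n l).map (sigmaEmbedding n) = alphabets n l := by
  rw [sigmaAlphabets, alphabets, ← List.map_coe_finRange_eq_range, List.map_map, List.map_map]
  rfl

theorem killCompl_powerSum (n : Fin r → ℕ) (i : Fin r) (k : ℕ+) :
    MvPowerSeries.killCompl (sigmaEmbedding n) (powerSum i k) =
      (((sigmaAlphabets n i).map fun x => X x ^ (k : ℕ)).sum : MvPolynomial _ ℚ) := by
  classical
  ext m
  have h_left : MvPowerSeries.coeff (m.embDomain (sigmaEmbedding n)) (powerSum i k) =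
      if ∃ a : Fin (n i), Finsupp.single ⟨i, a⟩ (k : ℕ) = m then 1 else 0 := by
    refine if_congr ⟨?_, ?_⟩ rfl rfl
    · rintro ⟨a, ha⟩
      obtain ⟨⟨l, b⟩, hb⟩ : (i, a) ∈ Set.range (sigmaEmbedding n) :=
        (Finsupp.mem_range_embDomain_iff _ _).1 ⟨m, ha⟩ (by simp)
      obtain ⟨rfl, rfl⟩ := Prod.ext_iff.1 hb
      exact ⟨b, Finsupp.embDomain_injective _ (by rw [ha, Finsupp.embDomain_single]; rfl)⟩
    · rintro ⟨a, rfl⟩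
      exact ⟨a, Finsupp.embDomain_single _ _ _⟩
  have h_right : coeff m ((sigmaAlphabets n i).map fun x => X x ^ (k : ℕ)).sum =
      ∑ a : Fin (n i), if Finsupp.single ⟨i, a⟩ (k : ℕ) = m then (1 : ℚ) else 0 := by
    simp only [sigmaAlphabets, ← List.ofFn_eq_map, List.map_ofFn, List.sum_ofFn, coeff_sum,
      Function.comp_apply, coeff_X_pow]
  rw [MvPowerSeries.coeff_killCompl, MvPolynomial.coeff_coe, h_left, h_right]
  split_ifs with h
  · obtain ⟨a, rfl⟩ := h
    simp [Finsupp.single_left_inj k.ne_zero]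
  · exact (Finset.sum_eq_zero fun a _ => if_neg fun ha => h ⟨a, ha⟩).symm

theorem killCompl_ofPowerSums (n : Fin r → ℕ) (f : MvPolynomial (Fin r × ℕ+) ℚ) :
    MvPowerSeries.killCompl (sigmaEmbedding n) (ofPowerSums r f) =
      (evalPowerSums (sigmaAlphabets n) f : MvPolynomial _ ℚ) := by
  have h_comp : (MvPowerSeries.killCompl (sigmaEmbedding n)).comp (ofPowerSums r) =
      (MvPolynomial.coeToMvPowerSeries.algHom ℚ).comp (evalPowerSums (sigmaAlphabets n)) :=
    algHom_ext fun q => by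
      simp [ofPowerSums, evalPowerSums_X, killCompl_powerSum]
  simpa using DFunLike.congr_fun h_comp f

theorem evalPowerSums_eq_of_ofPowerSums_eq {σ : Type*} {f g : MvPolynomial (Fin r × ℕ+) ℚ}
    (h : ofPowerSums r f = ofPowerSums r g) (v : Fin r → List σ) :
    evalPowerSums v f = evalPowerSums v g := by
  have h_sigma : evalPowerSums (sigmaAlphabets fun l => (v l).length) f =
      evalPowerSums (sigmaAlphabets fun l => (v l).length) g :=
    MvPolynomial.coe_injective _ _ (by rw [← killCompl_ofPowerSums, h, killCompl_ofPowerSums])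
  have h_letters : (fun l => (sigmaAlphabets (fun l => (v l).length) l).map
      fun a => (v a.1)[a.2]) = v := funext fun l => by
    rw [sigmaAlphabets, List.map_map]
    exact List.map_getElem_finRange _
  have h_rename := congrArg (rename fun a => (v a.1)[a.2]) h_sigma
  rwa [rename_evalPowerSums, rename_evalPowerSums, h_letters] at h_rename

theorem coeff_evalPowerSums_alphabets {n : Fin r → ℕ} {m : Fin r × ℕ →₀ ℕ}
    (h : ∀ v ∈ m.support, v.2 < n v.1) (f : MvPolynomial (Fin r × ℕ+) ℚ) :
    coeff m (evalPowerSums (alphabets n) f) = MvPowerSeries.coeff m (ofPowerSums r f) := by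
  obtain ⟨m, rfl⟩ : m ∈ Set.range (Finsupp.embDomain (sigmaEmbedding n)) :=
    (Finsupp.mem_range_embDomain_iff _ _).2 fun v hv => mem_range_sigmaEmbedding.2 (h v hv)
  rw [← MvPowerSeries.coeff_killCompl, killCompl_ofPowerSums, MvPolynomial.coeff_coe,
    ← coeff_rename_embDomain (sigmaEmbedding n), rename_evalPowerSums]
  simp only [map_sigmaEmbedding_sigmaAlphabets]

theorem eventually_forall_support_lt (m : Fin r × ℕ →₀ ℕ) :
    ∀ᶠ n : Fin r → ℕ in Filter.atTop, ∀ v ∈ m.support, v.2 < n v.1 :=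
  (Filter.eventually_all_finset _).2 fun v _ =>
    (Filter.eventually_ge_atTop fun _ => v.2 + 1).mono fun _ hn => hn v.1

end Truncation

section StableLimit

variable {r : ℕ} {lam : Fin r → Par}

theorem Represents.congr {σ : Type*} {bs : List (Fin r)} {s : Fin r → Multiset ℕ}
    {f g : MvPolynomial (Fin r × ℕ+) ℚ} (hf : Represents σ bs s f)
    (h : ofPowerSums r f = ofPowerSums r g) : Represents σ bs s g := fun v hv hs => by
  rw [hf v hv hs, evalPowerSums_eq_of_ofPowerSums_eq h]

theorem Represents.isStableLimit {f : MvPolynomial (Fin r × ℕ+) ℚ}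
    (hf : Represents (Fin r × ℕ) (List.finRange r) (fun l => (lam l).2.parts) f) :
    IsStableLimit (multiSchurPoly lam) (ofPowerSums r f) := fun m => by
  filter_upwards [eventually_forall_support_lt m,
    Filter.eventually_ge_atTop fun l => (lam l).2.parts.card] with n hm hn
  rw [multiSchurPoly_eq_keyWord lam hn, hf _ (isAlphabetFamily_alphabets n)
    (fun l _ => by rw [length_alphabets]; exact hn l), coeff_evalPowerSums_alphabets hm]

theorem IsStableLimit.unique {P : (Fin r → ℕ) → MvPolynomial (Fin r × ℕ) ℚ} {F G : Series r}
    (hF : IsStableLimit P F) (hG : IsStableLimit P G) : F = G := by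
  ext m
  obtain ⟨n, hFn, hGn⟩ := ((hF m).and (hG m)).exists
  exact hFn.symm.trans hGn

theorem IsStableLimit.multiSchur_eq {F : Series r} (hF : IsStableLimit (multiSchurPoly lam) F) :
    multiSchur lam = F := by
  have h : ∃ F, IsStableLimit (multiSchurPoly lam) F := ⟨F, hF⟩
  rw [multiSchur, dif_pos h]
  exact h.choose_spec.unique hF

end StableLimit

section Plethysm

variable {r : ℕ}

theorem coeff_sum_monomialSymm (j : Fin r) (m : ℕ)
    (μ : Fin r × ℕ →₀ ℕ) :
    MvPowerSeries.coeff μ (∑ lam : m.Partition, monomialSymm j lam) =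
      if (∀ v ∈ μ.support, v.1 = j) ∧ μ.degree = m then 1 else 0 := by
  classical
  rw [map_sum]
  change ∑ lam : m.Partition,
    (if (∀ v ∈ μ.support, v.1 = j) ∧ μ.support.val.map μ = lam.parts then (1 : ℚ) else 0) = _
  split_ifs with h
  · let lam : m.Partition :=
      { parts := μ.support.val.map μ
        parts_pos := fun {_} ha => by
          obtain ⟨v, hv, rfl⟩ := Multiset.mem_map.1 ha
          exact Nat.pos_of_ne_zero (Finsupp.mem_support_iff.1 hv)
        parts_sum := h.2 }
    rw [Finset.sum_eq_single_of_mem lam (Finset.mem_univ _)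
      fun nu _ hnu => if_neg fun h' => hnu (Nat.Partition.ext h'.2.symm)]
    exact if_pos ⟨h.1, rfl⟩
  · exact Finset.sum_eq_zero fun lam _ => if_neg fun h' =>
      h ⟨h'.1, (congrArg Multiset.sum h'.2).trans lam.parts_sum⟩

theorem ofPowerSums_completePS (j : Fin r) (m : ℕ) :
    ofPowerSums r (completePS j m) = ∑ lam : m.Partition, monomialSymm j lam := by
  classical
  ext μ
  obtain ⟨n, hn⟩ := (eventually_forall_support_lt μ).exists
  have h_mem : μ ∈ (alphabets n j).toFinset.finsuppAntidiag m ↔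
      (∀ v ∈ μ.support, v.1 = j) ∧ μ.degree = m := by
    rw [Finset.mem_finsuppAntidiag']
    have h_sub : μ.support ⊆ (alphabets n j).toFinset ↔ ∀ v ∈ μ.support, v.1 = j :=
      forall₂_congr fun v hv => by
        rw [List.mem_toFinset, alphabets, List.mem_map]
        refine ⟨?_, fun h => ⟨v.2, List.mem_range.2 (h ▸ hn v hv), Prod.ext h.symm rfl⟩⟩
        rintro ⟨a, -, rfl⟩
        rfl
    rw [h_sub, and_comm]
    rfl
  rw [← coeff_evalPowerSums_alphabets hn, evalPowerSums_completePS,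
    coeff_completeSeries_X ((isAlphabetFamily_alphabets n).nodup j), coeff_sum,
    coeff_sum_monomialSymm]
  simp only [coeff_monomial, Finset.sum_ite_eq', h_mem]

theorem zPow_neg_one_pow (k : ℕ) :
    (zPow (-1) : LaurentSeries (Series r)) ^ k = zPow (-(k : ℤ)) := by
  rw [zPow, HahnSeries.single_pow, one_pow, zPow, nsmul_eq_mul, mul_neg_one]

/-- Polynomials in the power sums, as Laurent series in `z` that do not depend on `z`. -/
noncomputable def laurentOfPowerSums (r : ℕ) :
    MvPolynomial (Fin r × ℕ+) ℚ →ₐ[ℚ] LaurentSeries (Series r) :=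
  RingHom.toRatAlgHom (HahnSeries.C.comp (ofPowerSums r : MvPolynomial _ ℚ →+* Series r))

theorem laurentOfPowerSums_apply (f : MvPolynomial (Fin r × ℕ+) ℚ) :
    laurentOfPowerSums r f = HahnSeries.C (ofPowerSums r f) :=
  rfl

theorem aeval_shift (i j : Fin r) (f : MvPolynomial (Fin r × ℕ+) ℚ) :
    aeval (fun q : Fin r × ℕ+ => shift i j q.1 q.2) f =
      (shiftPoly (Pi.single i 1 - Pi.single j 1) f).eval₂
        (laurentOfPowerSums r : MvPolynomial (Fin r × ℕ+) ℚ →+* LaurentSeries (Series r))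
        (zPow (-1)) := by
  refine (eval₂_shiftPoly (fun q => ?_) f).symm
  rw [aeval_X, shift, laurentOfPowerSums_apply, ofPowerSums, aeval_X, zPow_neg_one_pow,
    add_sub_assoc, Pi.sub_apply, sub_smul, Pi.single_apply, Pi.single_apply, ite_smul, ite_smul,
    one_smul, zero_smul]

theorem coeff_zero_eval₂_mul_omegaZ (j : Fin r)
    (g : Polynomial (MvPolynomial (Fin r × ℕ+) ℚ)) :
    (g.eval₂ (laurentOfPowerSums r : MvPolynomial (Fin r × ℕ+) ℚ →+* LaurentSeries (Series r))
        (zPow (-1)) * omegaZ j).coeff 0 =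
      ofPowerSums r (constTermOmega j g) := by
  rw [Polynomial.eval₂_eq_sum, Polynomial.sum, Finset.sum_mul, HahnSeries.coeff_sum, constTermOmega,
    Polynomial.sum, map_sum]
  refine Finset.sum_congr rfl fun m _ => ?_
  rw [map_mul, ofPowerSums_completePS, RingHom.coe_coe, laurentOfPowerSums_apply, zPow_neg_one_pow,
    zPow, HahnSeries.C_apply, HahnSeries.single_mul_single, zero_add, mul_one,
    ← add_neg_cancel (m : ℤ), HahnSeries.coeff_single_mul_add, omegaZ,
    HahnSeries.ofPowerSeries_apply_coeff, PowerSeries.coeff_mk]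

theorem coeff_zero_plethysm_mul_omegaZ (i j : Fin r) (F : Series r) :
    (plethysm (shift i j) F * omegaZ j).coeff 0 =
      ofPowerSums r (moveOp i j (Function.invFun (ofPowerSums r) F)) := by
  rw [plethysm, aeval_shift, coeff_zero_eval₂_mul_omegaZ, moveOp]

end Plethysm

section Parts

variable {r : ℕ}

theorem parts_ofMultiset {s : Multiset ℕ} (hs : ∀ x ∈ s, 0 < x) :
    (Nat.Partition.ofMultiset s).parts = s :=
  Multiset.filter_eq_self.2 fun x hx => (hs x hx).ne'

theorem Par.parts_removeLargest (lam : Par) :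
    lam.removeLargest.2.parts = lam.2.parts.erase lam.largest :=
  parts_ofMultiset fun _ hx => lam.2.parts_pos (Multiset.mem_of_mem_erase hx)

theorem Par.parts_insertPart (lam : Par) {p : ℕ} (hp : 0 < p) :
    (lam.insertPart p).2.parts = lam.2.parts + {p} := by
  rw [add_comm, Multiset.singleton_add]
  exact parts_ofMultiset (Multiset.forall_mem_cons.2 ⟨hp, fun _ => lam.2.parts_pos⟩)

theorem parts_moveLargest (lam : Fin r → Par) {i j : Fin r} (hij : i ≠ j)
    (hne : (lam i).2.parts ≠ 0) :
    (fun l => (moveLargest lam i j l).2.parts) =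
      Function.update (fun l => (lam l).2.parts) i ((lam i).2.parts.erase (lam i).largest) +
        Pi.single j {(lam i).largest} := by
  have h_pos : 0 < (lam i).largest := (lam i).2.parts_pos (sup_mem_of_ne_zero hne)
  funext l
  rw [Pi.add_apply, moveLargest]
  rcases eq_or_ne l j with rfl | hlj
  · rw [Function.update_self, Function.update_of_ne hij.symm, Pi.single_eq_same,
      Par.parts_insertPart _ h_pos]
  rw [Function.update_of_ne hlj, Pi.single_eq_of_ne hlj, add_zero]
  rcases eq_or_ne l i with rfl | hli
  · rw [Function.update_self, Function.update_self, Par.parts_removeLargest]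
  · rw [Function.update_of_ne hli, Function.update_of_ne hli]

theorem pair_infix_finRange {i j : Fin r} (hij : (j : ℕ) = i + 1) :
    [i, j] <:+: List.finRange r := by
  simpa [← hij] using getElem_pair_infix (l := List.finRange r) (k := i) (by simp [← hij])

end Parts

end MultiSchur

theorem mainTheorem5 {r : ℕ} (lam : Fin r → Par) (i j : Fin r) (hij : (j : ℕ) = i + 1)
    (hne : (lam i).2.parts ≠ 0) :
    IsStableLimit (multiSchurPoly lam) (multiSchur lam) ∧
    IsStableLimit (multiSchurPoly (moveLargest lam i j)) (multiSchur (moveLargest lam i j)) ∧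
    multiSchur lam ∈ MultiSym r ∧
    multiSchur (moveLargest lam i j) =
      (plethysm (shift i j) (multiSchur lam) * omegaZ j).coeff 0 := by
  have h_ne : i ≠ j := fun h => by simp [h] at hij
  obtain ⟨f, hf⟩ := exists_represents (σ := Fin r × ℕ) (List.nodup_finRange r)
    fun l => (lam l).2.parts
  have h_lim := hf.isStableLimit
  have h_eq := h_lim.multiSchur_eq
  set g := Function.invFun (ofPowerSums r) (multiSchur lam)
  have hg_eq : ofPowerSums r g = multiSchur lam := Function.invFun_eq ⟨f, h_eq.symm⟩
  have h_rep := hf.congr (h_eq.symm.trans hg_eq.symm)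
  rw [← update_erase_add_single (lam := fun l => (lam l).2.parts) (sup_mem_of_ne_zero hne)] at h_rep
  have h_moved := h_rep.move (List.nodup_finRange r) (pair_infix_finRange hij) fun x hx => by
    rw [Function.update_self] at hx
    exact Multiset.le_sup (Multiset.mem_of_mem_erase hx)
  have h_lim' := (parts_moveLargest lam h_ne hne ▸ h_moved).isStableLimit
  refine ⟨h_eq ▸ h_lim, h_lim'.multiSchur_eq ▸ h_lim', ⟨f, h_eq.symm⟩, ?_⟩
  rw [h_lim'.multiSchur_eq, coeff_zero_plethysm_mul_omegaZ]
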